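/- Let $R$ be a commutative ring, and let $\mathbf{Sym}=R\langle S_1,S_2,\dots\rangle$ be the Hopf algebra of noncommutative symmetric functions: the free associative $R$-algebra on generators $S_n$ ($n\ge 1$), with $S_0=1$ and the coproduct determined by $\Delta S_n=\sum_{i+j=n}S_i\otimes S_j$. Let $g(t)=\sum_{n\ge 0}g_nt^n\in\mathbf{Sym}[[t]]$ be the noncommutative Lagrange series, the unique solution of $$g(t)=\sum_{n\ge 0}S_n\,t^n g(t)^n ,$$ where $t$ commutes with the coefficients. For a composition $I=(i_1,\dots,i_r)$ (a finite, possibly empty, sequence of positive integers) put $g^I=g_{i_1}\cdots g_{i_r}$. A set partition of $[m]=\{1,\dots,m\}$ is noncrossing if there are no two distinct blocks $B,C$ and $a<b<c<d$ with $a,c\in B$ and $b,d\in C$. The ordered type of a noncrossing partition is the composition formed by the sizes of its blocks, ordered by increasing minima; its reduced ordered type is obtained by subtracting $1$ from every part and removing the zeros. Let $w_\pi$ be the permutation of $[m]$ whose cycles are the blocks of $\pi$ read in increasing order. The right Kreweras complement of a noncrossing partition $\pi$ is the noncrossing partition $\pi'$ with $w_{\pi'}=w_\pi^{-1}\gamma_m$,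 where $\gamma_m=(1\,2\,\cdots\,m)$ and permutations are composed from right to left. Theorem. The elements $g^I$, for all compositions $I$, form an $R$-basis of $\mathbf{Sym}$, and for every $n\ge 0$ the coefficient $a_{IJ}$ in the expansion $$\Delta g_n=\sum_{I,J}a_{IJ}\;g^I\otimes g^J$$ is equal to (the image in $R$ of) the number of noncrossing partitions $\pi$ of $[n+1]$ of reduced ordered type $I$ whose right Kreweras complement $\pi'$ has reduced ordered type $J$. -/

import Mathlib

open scoped TensorProduct PowerSeries

noncomputable section

/-! ## Noncommutative symmetric functions -/

/-- The algebra `Sym` of noncommutative symmetric functions over `R`: the free associative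
algebra on generators `S_n`, one for each positive integer `n`. -/
abbrev NSym (R : Type*) [CommRing R] : Type _ := FreeAlgebra R ℕ+

namespace NSym

variable (R : Type*) [CommRing R]

/-- The complete noncommutative symmetric functions `S_n`, with the convention `S_0 = 1`. -/
def S (n : ℕ) : NSym R := if h : 0 < n then FreeAlgebra.ι R (n.toPNat h) else 1

theorem S_zero : S R 0 = 1 := by simp [S]

theorem S_pnat (n : ℕ+) : S R n = FreeAlgebra.ι R n := by
  rw [S, dif_pos n.pos]; rfl

theorem lift_S {A : Type*} [Semiring A] [Algebra R A] (f : ℕ+ → A) (n : ℕ+) :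
    FreeAlgebra.lift R f (S R n) = f n := by
  rw [S_pnat, FreeAlgebra.lift_ι_apply]

theorem hom_ext {A : Type*} [Semiring A] [Algebra R A] {f g : NSym R →ₐ[R] A}
    (h : ∀ n : ℕ+, f (S R n) = g (S R n)) : f = g := by
  apply FreeAlgebra.hom_ext
  funext n
  simpa [S_pnat] using h n

/-- The coproduct: the algebra morphism with `Δ S_n = ∑_{i+j=n} S_i ⊗ S_j`. -/
def comulHom : NSym R →ₐ[R] NSym R ⊗[R] NSym R :=
  FreeAlgebra.lift R fun n => ∑ p ∈ Finset.HasAntidiagonal.antidiagonal (n : ℕ), S R p.1 ⊗ₜ[R] S R p.2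

/-- The counit: the algebra morphism with `S_n ↦ 0` for `n ≥ 1`. -/
def counitHom : NSym R →ₐ[R] R := FreeAlgebra.lift R fun _ => 0

theorem comulHom_S (n : ℕ) :
    comulHom R (S R n) = ∑ p ∈ Finset.HasAntidiagonal.antidiagonal n, S R p.1 ⊗ₜ[R] S R p.2 := by
  rcases Nat.eq_zero_or_pos n with rfl | h
  · simp [S_zero, Algebra.TensorProduct.one_def]
  · exact lift_S R _ ⟨n, h⟩

theorem counitHom_S (n : ℕ) : counitHom R (S R n) = if n = 0 then 1 else 0 := by
  rcases Nat.eq_zero_or_pos n with rfl | h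
  · simp [S_zero]
  · rw [if_neg h.ne']
    exact lift_S R _ ⟨n, h⟩

/-- The Hopf algebra of noncommutative symmetric functions, as a bialgebra (the antipode is
determined by the bialgebra structure and is not used). -/
instance : Bialgebra R (NSym R) :=
  Bialgebra.ofAlgHom (comulHom R) (counitHom R)
    (by
      apply hom_ext
      intro n
      simp only [AlgHom.comp_apply, comulHom_S, map_sum, Algebra.TensorProduct.map_tmul,
        AlgHom.id_apply, TensorProduct.sum_tmul, TensorProduct.tmul_sum]
      rw [Finset.sum_sigma', Finset.sum_sigma']
      refine Finset.sum_nbij' (fun x => ⟨(x.2.1, x.2.2 + x.1.2), (x.2.2, x.1.2)⟩)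
        (fun x => ⟨(x.1.1 + x.2.1, x.2.2), (x.1.1, x.2.1)⟩) ?_ ?_ ?_ ?_ ?_
      · rintro ⟨⟨a, b⟩, ⟨c, d⟩⟩ h
        simp at h ⊢
        omega
      · rintro ⟨⟨a, b⟩, ⟨c, d⟩⟩ h
        simp at h ⊢
        omega
      · rintro ⟨⟨a, b⟩, ⟨c, d⟩⟩ h
        simp at h ⊢
        obtain ⟨h1, rfl⟩ := h
        rfl
      · rintro ⟨⟨a, b⟩, ⟨c, d⟩⟩ h
        simp at h ⊢
        obtain ⟨h1, rfl⟩ := h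
        rfl
      · rintro ⟨⟨a, b⟩, ⟨c, d⟩⟩ h
        rfl)
    (by
      apply hom_ext
      intro n
      simp only [AlgHom.comp_apply, comulHom_S, map_sum, Algebra.TensorProduct.map_tmul,
        AlgHom.id_apply, counitHom_S]
      rw [Finset.sum_eq_single (0, (n : ℕ))]
      · simp
      · rintro ⟨a, b⟩ hab hne
        have : a ≠ 0 := by
          rintro rfl
          simp at hab
          exact hne (by simp [hab])
        simp [this]
      · simp)
    (by
      apply hom_ext
      intro n
      simp only [AlgHom.comp_apply, comulHom_S, map_sum, Algebra.TensorProduct.map_tmul,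
        AlgHom.id_apply, counitHom_S]
      rw [Finset.sum_eq_single ((n : ℕ), 0)]
      · simp
      · rintro ⟨a, b⟩ hab hne
        have : b ≠ 0 := by
          rintro rfl
          simp at hab
          exact hne (by simp [hab])
        simp [this]
      · simp)

/-! ## The noncommutative Lagrange series -/

/-- The right-hand side `∑_{k ≥ 0} S_k t^k g(t)^k` of the functional equation of the Lagrange
series, given through its coefficients (`t` commutes with all coefficients). -/
def lagrangeRHS (g : (NSym R)⟦X⟧) : (NSym R)⟦X⟧ :=
  PowerSeries.mk fun n => ∑ k ∈ Finset.range (n + 1), S R k * PowerSeries.coeff (n - k) (g ^ k)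

/-- The components `g_n` of the Lagrange series, by recursion: `g_n` is the coefficient of `t^n`
in `∑_k S_k t^k g(t)^k`, which only involves `g_0, …, g_{n-1}`. -/
def g (n : ℕ) : NSym R :=
  PowerSeries.coeff n (lagrangeRHS R (PowerSeries.mk fun m => if _h : m < n then g m else 0))
termination_by n

/-- The Lagrange series `g(t) = ∑_n g_n t^n`. -/
def lagrange : (NSym R)⟦X⟧ := PowerSeries.mk (g R)

theorem coeff_pow_congr {A : Type*} [Semiring A] {a b : A⟦X⟧} {N : ℕ}
    (h : ∀ m < N, PowerSeries.coeff m a = PowerSeries.coeff m b) (k : ℕ) :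
    ∀ m < N, PowerSeries.coeff m (a ^ k) = PowerSeries.coeff m (b ^ k) := by
  induction k with
  | zero => simp
  | succ k ih =>
    intro m hm
    rw [pow_succ, pow_succ, PowerSeries.coeff_mul, PowerSeries.coeff_mul]
    refine Finset.sum_congr rfl fun p hp => ?_
    have := Finset.HasAntidiagonal.mem_antidiagonal.1 hp
    rw [ih p.1 (by omega), h p.2 (by omega)]

theorem coeff_lagrangeRHS_congr {a b : (NSym R)⟦X⟧} {n : ℕ}
    (h : ∀ m < n, PowerSeries.coeff m a = PowerSeries.coeff m b) :
    PowerSeries.coeff n (lagrangeRHS R a) = PowerSeries.coeff n (lagrangeRHS R b) := by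
  simp only [lagrangeRHS, PowerSeries.coeff_mk]
  refine Finset.sum_congr rfl fun k hk => ?_
  rcases Nat.eq_zero_or_pos k with rfl | hk0
  · simp
  · rw [coeff_pow_congr h k (n - k) (by have := Finset.mem_range.1 hk; omega)]

/-- `g(t)` satisfies the functional equation `g(t) = ∑_k S_k t^k g(t)^k`. -/
theorem lagrange_eq : lagrange R = lagrangeRHS R (lagrange R) := by
  ext n
  rw [lagrange, PowerSeries.coeff_mk, g]
  apply coeff_lagrangeRHS_congr
  intro m hm
  simp [hm]

/-- `g(t)` is the only solution of the functional equation. -/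
theorem eq_lagrange {a : (NSym R)⟦X⟧} (ha : a = lagrangeRHS R a) : a = lagrange R := by
  ext n
  induction n using Nat.strong_induction_on with
  | _ n ih =>
    rw [ha, lagrange_eq]
    exact coeff_lagrangeRHS_congr R ih

/-- `g^I = g_{i_1} ⋯ g_{i_r}` for a composition `I = (i_1, …, i_r)`, i.e. a finite (possibly
empty) sequence of positive integers. -/
def gComp (I : List ℕ+) : NSym R := (I.map fun i => g R (i : ℕ)).prod

end NSym

/-! ## Noncrossing partitions -/

/-- The ground set `[m] = {1, …, m}` is represented by `Fin m = {0, …, m - 1}`. -/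
abbrev SetPartition (m : ℕ) : Type := Finpartition (Finset.univ : Finset (Fin m))

namespace SetPartition

variable {m : ℕ}

/-- No two distinct blocks `B`, `C` contain `a < b < c < d` with `a, c ∈ B` and `b, d ∈ C`. -/
def IsNoncrossing (π : SetPartition m) : Prop :=
  ∀ B ∈ π.parts, ∀ C ∈ π.parts, B ≠ C →
    ∀ a ∈ B, ∀ b ∈ C, ∀ c ∈ B, ∀ d ∈ C, ¬ (a < b ∧ b < c ∧ c < d)

/-- The ordered type: the sizes of the blocks, ordered by increasing minima of the blocks. (An
element is the minimum of a block exactly when it is the smallest element of its own block.) -/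
def orderedType (π : SetPartition m) : List ℕ :=
  ((List.finRange m).filter fun x => decide (∀ y ∈ π.part x, x ≤ y)).map fun x => (π.part x).card

/-- The reduced ordered type: subtract `1` from each part of the ordered type (all of these are
at least `1`) and remove the zeros. -/
def reducedOrderedType (π : SetPartition m) : List ℕ :=
  (π.orderedType.map fun k => k - 1).filter fun k => decide (k ≠ 0)

/-- The cycle `(b_1 b_2 … b_k)` on a block `B = {b_1 < b_2 < ⋯ < b_k}`. -/
def blockCycle (B : Finset (Fin m)) : Equiv.Perm (Fin m) := (B.sort (· ≤ ·)).formPerm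

theorem part_blockCycle (π : SetPartition m) (x : Fin m) :
    π.part (blockCycle (π.part x) x) = π.part x := by
  apply π.part_eq_of_mem (by simp)
  have h : x ∈ (π.part x).sort (· ≤ ·) := by simp
  exact (Finset.mem_sort _).1 (List.formPerm_apply_mem_of_mem h)

theorem part_blockCycle_symm (π : SetPartition m) (x : Fin m) :
    π.part ((blockCycle (π.part x)).symm x) = π.part x := by
  apply π.part_eq_of_mem (by simp)
  have h : (blockCycle (π.part x)) ((blockCycle (π.part x)).symm x) ∈
      (π.part x).sort (· ≤ ·) := by simp
  have := List.mem_of_formPerm_apply_mem h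
  simpa using this

/-- The permutation `w_π` whose cycles are the blocks of `π`, each read in increasing order. -/
def toPerm (π : SetPartition m) : Equiv.Perm (Fin m) where
  toFun x := blockCycle (π.part x) x
  invFun x := (blockCycle (π.part x)).symm x
  left_inv x := by
    change (blockCycle (π.part (blockCycle (π.part x) x))).symm _ = x
    rw [part_blockCycle]; simp
  right_inv x := by
    change blockCycle (π.part ((blockCycle (π.part x)).symm x)) _ = x
    rw [part_blockCycle_symm]; simp

/-- `π'` is the right Kreweras complement of `π`: the noncrossing partition with
`w_{π'} = w_π⁻¹ γ`, where `γ = (1 2 … m)` is the long cycle and the product of permutations is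
composition (the right factor acts first). It is unique, as `π ↦ w_π` is injective. -/
def IsRightKrewerasComplement (π π' : SetPartition m) : Prop :=
  π'.IsNoncrossing ∧ π'.toPerm = π.toPerm⁻¹ * finRotate m

end SetPartition

end

noncomputable section

/-! ## Noncrossing permutations -/

namespace NCPerm

open Equiv

variable {α : Type*}

-- Put X_i = g_i ⊗ 1 and Y_j = 1 ⊗ g_j in Sym ⊗ Sym; every X_i commutes with every Y_j. The proof
-- computes in two ways the product AB of the solutions of the coupled system A = ∑ X_k t^k B^k, B =
-- ∑ Y_k t^k A^k.
--
-- Algebra. Induction on the degree gives AB = BA (`coupled_comm`), so A behaves like the first copy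
-- of the Lagrange series evaluated at tB. The Lagrange equation then turns into A = ∑ (S_k ⊗ 1) t^k
-- (AB)^k, symmetrically for B, and together AB = ∑ ΔS_n t^n (AB)^n (`coupled_mul`). The series
-- Δg(t) solves the same equation, whose solution is unique, so Δg(t) = AB.
--
-- Combinatorics. A noncrossing partition is handled through its permutation, in which each cycle is
-- weighted by an X and each cycle of the Kreweras complement by a Y. A enumerates the noncrossing
-- permutations of an interval that send the last point to the first, B those that fix the first
-- point. Either kind splits uniquely into a B-permutation followed by an A-permutation, joined by a
-- transposition for A and merely juxtaposed for B; hence both are encoded by binary trees. The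
-- complement interchanges joining and juxtaposing (`kreweras_swap_mul`, `kreweras_mul`). The cycle
-- of the first point therefore grows along the right branch in A, its complementary cycle along the
-- left branch in B, and this is the coupled system. Appending a point to the block of the first one
-- identifies the noncrossing partitions of an (n+1)-set with the trees with n+1 nodes, whose two
-- subtrees produce the coefficient of t^n in AB (`sum_word_eq_coeff`).
--
-- Types are recorded by `rho`: as X_0 = 1, the product of the X at `rho w x` over the points x in
-- order sees only the reduced ordered type. Permutations act on all of ℕ so that subtrees can live
-- on shifted intervals.
--
-- Basis. The Lagrange equation can be solved recursively for the S_n, so S_n ↦ g_n is an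
-- automorphism of the free algebra and carries the monomial basis to the g^I.

theorem apply_inv_apply (w : Perm α) (x : α) : w (w⁻¹ x) = x := w.apply_symm_apply x

theorem inv_apply_apply (w : Perm α) (x : α) : w⁻¹ (w x) = x := w.symm_apply_apply x

/-- Being in the same cycle is the least equivalence relation relating each x to w x. Facts about
cycles are deduced from this instead of from integer powers. -/
theorem sameCycle_le {w : Perm α} {r : α → α → Prop} (hr : Equivalence r)
    (h : ∀ x, r x (w x)) {x y : α} (hxy : w.SameCycle x y) : r x y := by
  have hn : ∀ (n : ℕ) x, r x ((w ^ n) x) := by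
    intro n
    induction n with
    | zero => intro x; exact hr.refl x
    | succ n ih =>
      intro x
      rw [pow_succ, Perm.mul_apply]
      exact hr.trans (h x) (ih (w x))
  obtain ⟨i, rfl⟩ := hxy
  rcases i with n | n
  · simpa using hn n x
  · have := hn (n + 1) ((w ^ (Int.negSucc n)) x)
    rw [zpow_negSucc, apply_inv_apply] at this
    rw [zpow_negSucc]
    exact hr.symm this

theorem sameCycle_of_eqOn {w v : Perm α} {s : Set α} (hw : ∀ y, w y ∈ s ↔ y ∈ s)
    (h : ∀ y ∈ s, w y = v y) {x y : α} (hx : x ∈ s) (hxy : w.SameCycle x y) :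
    y ∈ s ∧ v.SameCycle x y := by
  have := sameCycle_le (w := w)
    (r := fun x y => (x ∈ s ↔ y ∈ s) ∧ (x ∈ s → v.SameCycle x y)) ?_ ?_ hxy
  · exact ⟨this.1.1 hx, this.2 hx⟩
  · refine ⟨fun x => ⟨Iff.rfl, fun _ => .refl _ _⟩, fun h => ⟨h.1.symm, fun hy => ?_⟩,
      fun h h' => ⟨h.1.trans h'.1, fun hx => ?_⟩⟩
    · exact (h.2 (h.1.2 hy)).symm
    · exact (h.2 hx).trans (h'.2 (h.1.1 hx))
  · intro x
    refine ⟨(hw x).symm, fun hx => ?_⟩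
    rw [h x hx]
    exact ⟨1, by simp⟩

theorem sameCycle_congr {w v : Perm α} {s : Set α} (hw : ∀ y, w y ∈ s ↔ y ∈ s)
    (hv : ∀ y, v y ∈ s ↔ y ∈ s) (h : ∀ y ∈ s, w y = v y) {x y : α} (hx : x ∈ s) :
    w.SameCycle x y ↔ v.SameCycle x y :=
  ⟨fun hxy => (sameCycle_of_eqOn hw h hx hxy).2,
    fun hxy => (sameCycle_of_eqOn hv (fun y hy => (h y hy).symm) hx hxy).2⟩

open Classical in
/-- One less than the size of the cycle of `x` if `x` is its minimum, and zero otherwise. -/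
def rho [LE α] (w : Perm α) (x : α) : ℕ :=
  if ∀ y, w.SameCycle x y → x ≤ y then {y | w.SameCycle x y}.ncard - 1 else 0

theorem rho_eq_of_sameCycle [LE α] {w v : Perm α} {x : α}
    (h : ∀ y, w.SameCycle x y ↔ v.SameCycle x y) : rho w x = rho v x := by
  have : w.SameCycle x = v.SameCycle x := funext fun y => propext (h y)
  rw [rho, rho, this]

theorem rho_congr [LE α] {w v : Perm α} {s : Set α} (hw : ∀ y, w y ∈ s ↔ y ∈ s)
    (hv : ∀ y, v y ∈ s ↔ y ∈ s) (h : ∀ y ∈ s, w y = v y) {x : α} (hx : x ∈ s) :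
    rho w x = rho v x :=
  rho_eq_of_sameCycle fun _ => sameCycle_congr hw hv h hx

theorem rho_of_not_min [LE α] {w : Perm α} {x y : α} (h : w.SameCycle x y) (hxy : ¬ x ≤ y) :
    rho w x = 0 := if_neg fun H => hxy (H y h)

theorem rho_of_fixed [LE α] {w : Perm α} {x : α} (h : w x = x) : rho w x = 0 := by
  have : {y | w.SameCycle x y} = {x} := by
    ext y
    simp only [Set.mem_ofPred_eq, Set.mem_singleton_iff]
    refine ⟨fun hy => ?_, fun hy => hy ▸ .refl _ _⟩
    have := sameCycle_of_eqOn (w := w) (v := 1) (s := {x})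
      (fun y => ⟨fun hy => w.injective (by rw [h]; exact hy), fun hy => by
        rw [Set.mem_singleton_iff.1 hy, h]; rfl⟩)
      (fun y hy => by rw [Set.mem_singleton_iff.1 hy, h]; rfl) rfl hy
    exact this.1
  rw [rho, this]
  simp

/-- Inserting a fixed point `q` of `v` in front of `z`. -/
theorem sameCycle_insert [DecidableEq α] {v : Perm α} {q z : α} (hq : v q = q) (hz : z ≠ q)
    {x y : α} :
    (swap q z * v).SameCycle x y ↔
      v.SameCycle (if x = q then z else x) (if y = q then z else y) := by
  set w := swap q z * v with hw
  have hwz : w.SameCycle z q := by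
    refine ⟨-1, ?_⟩
    rw [zpow_neg_one, Perm.inv_eq_iff_eq, hw, Perm.mul_apply, hq, swap_apply_left]
  have hself : ∀ x, w.SameCycle x (if x = q then z else x) := by
    intro x
    split_ifs with h
    · rw [h]; exact hwz.symm
    · exact .refl _ _
  constructor
  · refine sameCycle_le (r := fun x y => v.SameCycle (if x = q then z else x)
      (if y = q then z else y)) ⟨fun _ => .refl _ _, fun h => h.symm, fun h h' => h.trans h'⟩ ?_
    intro x
    rw [hw, Perm.mul_apply]
    by_cases hx : x = q
    · rw [if_pos hx, hx, hq, swap_apply_left, if_neg hz]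
    · rw [if_neg hx]
      have hvx : v x ≠ q := fun h => hx (v.injective (h.trans hq.symm))
      by_cases hxz : v x = z
      · rw [hxz, swap_apply_right, if_pos rfl, ← hxz]
        exact ⟨1, by simp⟩
      · rw [swap_apply_of_ne_of_ne hvx hxz, if_neg hvx]
        exact ⟨1, by simp⟩
  · intro h
    have key : w.SameCycle (if x = q then z else x) (if y = q then z else y) := by
      refine sameCycle_le (w := v) (r := w.SameCycle)
        ⟨fun _ => .refl _ _, fun h => h.symm, fun h h' => h.trans h'⟩ ?_ h
      intro x
      by_cases hx : x = q
      · rw [hx, hq]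
      have hvx : v x ≠ q := fun h => hx (v.injective (h.trans hq.symm))
      by_cases hxz : v x = z
      · rw [hxz]
        refine Perm.SameCycle.trans (y := q) ⟨1, ?_⟩ hwz.symm
        rw [zpow_one, hw, Perm.mul_apply, hxz, swap_apply_right]
      · refine ⟨1, ?_⟩
        rw [zpow_one, hw, Perm.mul_apply, swap_apply_of_ne_of_ne hvx hxz]
    exact ((hself x).trans key).trans (hself y).symm

theorem not_sameCycle_fixed {v : Perm α} {q z : α} (hq : v q = q) (hz : z ≠ q) : ¬ v.SameCycle z q := by
  intro h
  obtain ⟨i, hi⟩ := h.symm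
  rw [Perm.zpow_apply_eq_self_of_apply_eq_self hq] at hi
  exact hz hi.symm

-- Effect on `rho` of inserting a point into a cycle

section Insert

variable [LinearOrder α] {v : Perm α} {q z : α}

theorem sameCycle_insert_set (hq : v q = q) (hz : z ≠ q) {x : α}
    (hx : x = q ∨ v.SameCycle z x) :
    {y | (swap q z * v).SameCycle x y} = insert q {y | v.SameCycle z y} := by
  have hx' : v.SameCycle (if x = q then z else x) z := by
    rcases hx with hx | hx
    · rw [if_pos hx]
    · split_ifs
      · exact .refl _ _
      · exact hx.symm
  ext y
  simp only [Set.mem_ofPred_eq, sameCycle_insert hq hz, Set.mem_insert_iff]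
  by_cases hy : y = q
  · simp [hy, hx']
  · simp only [hy, if_false, false_or]
    exact ⟨fun h => hx'.symm.trans h, fun h => hx'.trans h⟩

/-- The cycle of z absorbs q and grows by one, and its size is recorded at its minimum. The point q
may lie on either side of z: gluing inserts it on the left, appending a last point on the right. -/
theorem rho_insert_min (hq : v q = q) (hz : z ≠ q) (hmin : ∀ y, v.SameCycle z y → z ≤ y)
    (hfin : {y | v.SameCycle z y}.Finite) :
    rho (swap q z * v) (min q z) = rho v z + 1 := by
  have hmem : min q z = q ∨ v.SameCycle z (min q z) := by
    rcases min_choice q z with h | h <;> rw [h]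
    · exact Or.inl rfl
    · exact Or.inr (.refl _ _)
  have hset := sameCycle_insert_set hq hz hmem
  have hcard := Set.ncard_insert_of_notMem (s := {y | v.SameCycle z y})
    (not_sameCycle_fixed hq hz) hfin
  rw [rho, hset, if_pos, rho, if_pos hmin, hcard]
  · have : 0 < {y | v.SameCycle z y}.ncard := (Set.ncard_pos hfin).2 ⟨z, .refl _ _⟩
    omega
  · intro y hy
    have : y ∈ insert q {y | v.SameCycle z y} := hset ▸ hy
    rcases this with rfl | h
    · exact min_le_left _ _
    · exact (min_le_right _ _).trans (hmin y h)

theorem rho_insert_max (hq : v q = q) (hz : z ≠ q) :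
    rho (swap q z * v) (max q z) = 0 := by
  have h : (swap q z * v).SameCycle q z := by
    rw [sameCycle_insert hq hz, if_pos rfl, if_neg hz]
  rcases lt_or_gt_of_ne hz with h' | h'
  · rw [max_eq_left h'.le]
    exact rho_of_not_min h h'.not_ge
  · rw [max_eq_right h'.le]
    exact rho_of_not_min h.symm h'.not_ge

/-- In the cycle of z, a point other than z and q is not the minimum before or after the insertion;
every other cycle is untouched. -/
theorem rho_insert_of_ne (hq : v q = q) (hz : z ≠ q)
    (hmin : ∀ y, v.SameCycle z y → z ≤ y) {x : α} (hxq : x ≠ q) (hxz : x ≠ z) :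
    rho (swap q z * v) x = rho v x := by
  by_cases hx : v.SameCycle z x
  · have hlt : ¬ x ≤ z := not_le.2 (lt_of_le_of_ne (hmin x hx) (Ne.symm hxz))
    rw [rho_of_not_min hx.symm hlt]
    refine rho_of_not_min (y := z) ?_ hlt
    rw [sameCycle_insert hq hz, if_neg hxq, if_neg hz]
    exact hx.symm
  · have : ∀ y, (swap q z * v).SameCycle x y ↔ v.SameCycle x y := by
      intro y
      rw [sameCycle_insert hq hz, if_neg hxq]
      split_ifs with h
      · subst h
        refine ⟨fun h => (hx h.symm).elim, fun h => ?_⟩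
        obtain ⟨i, hi⟩ := h.symm
        rw [Perm.zpow_apply_eq_self_of_apply_eq_self hq] at hi
        exact (hxq hi.symm).elim
      · rfl
    exact rho_eq_of_sameCycle this

end Insert

/-! ### The noncrossing condition -/

/-- A permutation of a linear order whose cycles are increasing and form a noncrossing
partition. -/
structure IsNC [LinearOrder α] (w : Perm α) : Prop where
  up : ∀ x y, x < y → y < w x → x < w y ∧ w y < w x
  down : ∀ x y, w x ≤ y → y ≤ x → w x ≤ w y ∧ w y ≤ x

/-- A permutation of `ℕ` fixes all points outside the interval `[a, a + n]`. -/
def SuppIn (w : Perm ℕ) (a n : ℕ) : Prop := ∀ x, x < a ∨ a + n < x → w x = x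

/-- A noncrossing permutation of the interval `[a, a + n]`. -/
structure IsNCOn (w : Perm ℕ) (a n : ℕ) : Prop extends IsNC w where
  supp : SuppIn w a n

theorem SuppIn.mem_iff {w : Perm ℕ} {a n : ℕ} (h : SuppIn w a n) (x : ℕ) :
    w x ∈ Set.Icc a (a + n) ↔ x ∈ Set.Icc a (a + n) := by
  simp only [Set.mem_Icc]
  by_cases hx : x < a ∨ a + n < x
  · rw [h x hx]
  · by_cases hwx : w x < a ∨ a + n < w x
    · have := w.injective (h _ hwx)
      omega
    · omega

theorem SuppIn.bounds {w : Perm ℕ} {a n : ℕ} (h : SuppIn w a n) {x : ℕ} (h1 : a ≤ x)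
    (h2 : x ≤ a + n) : a ≤ w x ∧ w x ≤ a + n := (h.mem_iff x).2 ⟨h1, h2⟩

theorem SuppIn.mono {w : Perm ℕ} {a n b k : ℕ} (h : SuppIn w a n) (hab : b ≤ a)
    (hn : a + n ≤ b + k) : SuppIn w b k := fun x hx => h x (by omega)

theorem SuppIn.inv {w : Perm ℕ} {a n : ℕ} (h : SuppIn w a n) : SuppIn w⁻¹ a n :=
  fun x hx => by rw [Perm.inv_eq_iff_eq, h x hx]

theorem SuppIn.mul {w v : Perm ℕ} {a n : ℕ} (hw : SuppIn w a n) (hv : SuppIn v a n) :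
    SuppIn (w * v) a n := fun x hx => by rw [Perm.mul_apply, hv x hx, hw x hx]

theorem SuppIn.swap {a n x y : ℕ} (hx : a ≤ x ∧ x ≤ a + n) (hy : a ≤ y ∧ y ≤ a + n) :
    SuppIn (Equiv.swap x y) a n := fun z hz => swap_apply_of_ne_of_ne (by omega) (by omega)

theorem SuppIn.sameCycle {w : Perm ℕ} {a n : ℕ} (h : SuppIn w a n) {x y : ℕ} (h1 : a ≤ x)
    (h2 : x ≤ a + n) (hxy : w.SameCycle x y) : a ≤ y ∧ y ≤ a + n :=
  (sameCycle_of_eqOn (v := w) h.mem_iff (fun _ _ => rfl) ⟨h1, h2⟩ hxy).1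

theorem SuppIn.finite {w : Perm ℕ} {a n : ℕ} (h : SuppIn w a n) {x : ℕ} (h1 : a ≤ x)
    (h2 : x ≤ a + n) : {y | w.SameCycle x y}.Finite :=
  (Set.finite_Icc a (a + n)).subset fun _ hy => h.sameCycle h1 h2 hy

/-- Pigeonhole: an injective self-map of a finite interval is onto. It serves to show that points
outside a stable interval stay outside. -/
theorem inv_mem_of_maps {w : Perm ℕ} {a b : ℕ} (h : ∀ x, a ≤ x → x ≤ b → a ≤ w x ∧ w x ≤ b)
    {x : ℕ} (h1 : a ≤ x) (h2 : x ≤ b) : a ≤ w⁻¹ x ∧ w⁻¹ x ≤ b := by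
  have := Finset.surjOn_of_injOn_of_card_le (s := Finset.Icc a b) (t := Finset.Icc a b) w
    (fun x hx => by
      simp only [Finset.coe_Icc, Set.mem_Icc] at hx ⊢
      exact h x hx.1 hx.2) w.injective.injOn le_rfl
  obtain ⟨y, hy, rfl⟩ := this (Finset.mem_coe.2 (Finset.mem_Icc.2 ⟨h1, h2⟩))
  rw [inv_apply_apply]
  exact Finset.mem_Icc.1 (Finset.mem_coe.1 hy)

/-- The long cycle on the interval `[a, a + n]`. -/
def longCycle (a n : ℕ) : Perm ℕ where
  toFun x := if a ≤ x ∧ x < a + n then x + 1 else if x = a + n then a else x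
  invFun x := if a < x ∧ x ≤ a + n then x - 1 else if x = a then a + n else x
  left_inv x := by dsimp only; split_ifs <;> omega
  right_inv x := by dsimp only; split_ifs <;> omega

theorem longCycle_apply (a n x : ℕ) :
    longCycle a n x = if a ≤ x ∧ x < a + n then x + 1 else if x = a + n then a else x := rfl

theorem longCycle_supp (a n : ℕ) : SuppIn (longCycle a n) a n := fun x hx => by
  rw [longCycle_apply]
  split_ifs <;> omega

/-- The right Kreweras complement of a permutation of `[a, a + n]`. -/
def kreweras (w : Perm ℕ) (a n : ℕ) : Perm ℕ := w⁻¹ * longCycle a n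

theorem apply_kreweras (w : Perm ℕ) (a n x : ℕ) : w (kreweras w a n x) = longCycle a n x := by
  rw [kreweras, Perm.mul_apply, apply_inv_apply]

theorem SuppIn.kreweras {w : Perm ℕ} {a n : ℕ} (h : SuppIn w a n) : SuppIn (kreweras w a n) a n :=
  h.inv.mul (longCycle_supp a n)

/-- If y is the image of x < a + n under the complement, then w y = x + 1. The w-stable intervals [w
y, y] and (y, w y) thus become [x + 1, y] and (y, x + 1), and z ↦ w⁻¹ (z + 1) stays inside them. -/
theorem IsNCOn.kreweras {w : Perm ℕ} {a n : ℕ} (h : IsNCOn w a n) :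
    IsNCOn (kreweras w a n) a n := by
  have hs := h.supp.kreweras
  refine ⟨⟨?_, ?_⟩, hs⟩
  · intro x z hxz hz
    have hx1 : a ≤ x ∧ x ≤ a + n := by
      by_contra hx
      rw [hs x (by omega)] at hz
      omega
    have hy := hs.bounds hx1.1 hx1.2
    have e := apply_kreweras w a n x
    have e' := apply_kreweras w a n z
    set y := NCPerm.kreweras w a n x
    set y' := NCPerm.kreweras w a n z
    rw [longCycle_apply, if_pos (by omega)] at e e'
    have := inv_mem_of_maps (h.down y) (x := z + 1) (by omega) (by omega)
    rw [← e', inv_apply_apply] at this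
    have hne : y' ≠ y := fun h => by rw [h] at e'; omega
    omega
  · intro x z hxz hz
    by_cases hx1 : a ≤ x ∧ x ≤ a + n
    swap
    · have := hs x (by omega)
      rw [this] at hxz ⊢
      obtain rfl : x = z := by omega
      omega
    have hy := hs.bounds hx1.1 hx1.2
    have e := apply_kreweras w a n x
    have e' := apply_kreweras w a n z
    rcases Nat.eq_or_lt_of_le hz with rfl | hzx
    · omega
    set y := NCPerm.kreweras w a n x
    set y' := NCPerm.kreweras w a n z
    rw [longCycle_apply, if_pos (by omega)] at e'
    -- At the last point the long cycle wraps around, so w y = a; stability of [a, y] takes over the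
    -- argument.
    by_cases hxn : x = a + n
    · rw [longCycle_apply, if_neg (by omega), if_pos hxn] at e
      by_contra hcon
      have hb := h.supp.bounds (x := y') 
      have hb2 := hs.bounds (x := z) (by omega) (by omega)
      have := h.down y y' (by rw [e]; exact hb2.1) (by omega)
      omega
    · rw [longCycle_apply, if_pos (by omega)] at e
      have := inv_mem_of_maps (w := w) (a := y + 1) (b := x) (fun u h1 h2 => by
        have := h.up y u (by omega) (by omega)
        omega) (x := z + 1) (by omega) (by omega)
      rw [← e', inv_apply_apply] at this
      omega

end NCPerm

namespace NCPerm

open Equiv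

/-! ### Gluing permutations of adjacent intervals -/

section Glue

variable {w₁ w₂ : Perm ℕ} {a m n : ℕ}

theorem mul_apply_left (h₂ : SuppIn w₂ (a + m + 1) n) {x : ℕ} (hx : x ≤ a + m) :
    (w₁ * w₂) x = w₁ x := by
  rw [Perm.mul_apply, h₂ x (by omega)]

theorem mul_apply_right (h₁ : SuppIn w₁ a m) (h₂ : SuppIn w₂ (a + m + 1) n) {x : ℕ}
    (hx : a + m + 1 ≤ x) : (w₁ * w₂) x = w₂ x := by
  rw [Perm.mul_apply]
  apply h₁
  by_cases hxn : x ≤ a + m + 1 + n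
  · have := h₂.bounds hx hxn
    omega
  · rw [h₂ x (by omega)]
    omega

theorem mul_comm_of_supp (h₁ : SuppIn w₁ a m) (h₂ : SuppIn w₂ (a + m + 1) n) :
    w₁ * w₂ = w₂ * w₁ := by
  ext x
  rw [Perm.mul_apply w₂]
  by_cases hx : a ≤ x ∧ x ≤ a + m
  · have := h₁.bounds hx.1 hx.2
    rw [mul_apply_left h₂ hx.2, h₂ (w₁ x) (by omega)]
  · rw [h₁ x (by omega)]
    by_cases hx' : x ≤ a + m
    · rw [mul_apply_left h₂ hx', h₁ x (by omega), h₂ x (by omega)]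
    · rw [mul_apply_right h₁ h₂ (by omega)]

theorem supp_mul (h₁ : SuppIn w₁ a m) (h₂ : SuppIn w₂ (a + m + 1) n) :
    SuppIn (w₁ * w₂) a (m + n + 1) :=
  (h₁.mono le_rfl (by omega)).mul (h₂.mono (by omega) (by omega))

theorem rho_mul_left (h₁ : SuppIn w₁ a m) (h₂ : SuppIn w₂ (a + m + 1) n) {x : ℕ} (hx : a ≤ x)
    (hx' : x ≤ a + m) : rho (w₁ * w₂) x = rho w₁ x := by
  refine rho_congr (s := Set.Icc a (a + m)) (fun y => ?_) h₁.mem_iff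
    (fun y hy => mul_apply_left h₂ hy.2) ⟨hx, hx'⟩
  by_cases hy : y ≤ a + m
  · rw [mul_apply_left h₂ hy, h₁.mem_iff]
  · have : a + m + 1 ≤ (w₁ * w₂) y := by
      rw [mul_apply_right h₁ h₂ (by omega)]
      by_cases hyn : y ≤ a + m + 1 + n
      · exact (h₂.bounds (by omega) hyn).1
      · rw [h₂ y (by omega)]
        omega
    simp only [Set.mem_Icc]
    omega

theorem mul_mem_iff_right (h₁ : SuppIn w₁ a m) (h₂ : SuppIn w₂ (a + m + 1) n) (y : ℕ) :
    (w₁ * w₂) y ∈ Set.Icc (a + m + 1) (a + m + 1 + n) ↔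
      y ∈ Set.Icc (a + m + 1) (a + m + 1 + n) := by
  by_cases hy : y ≤ a + m
  · have : w₁ y ≤ a + m := by
      by_cases hya : a ≤ y
      · exact (h₁.bounds hya hy).2
      · rw [h₁ y (by omega)]
        omega
    rw [mul_apply_left h₂ hy]
    simp only [Set.mem_Icc]
    omega
  · rw [mul_apply_right h₁ h₂ (by omega), h₂.mem_iff]

theorem rho_mul_right (h₁ : SuppIn w₁ a m) (h₂ : SuppIn w₂ (a + m + 1) n) {x : ℕ}
    (hx : a + m + 1 ≤ x) (hx' : x ≤ a + m + 1 + n) : rho (w₁ * w₂) x = rho w₂ x :=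
  rho_congr (s := Set.Icc (a + m + 1) (a + m + 1 + n)) (mul_mem_iff_right h₁ h₂) h₂.mem_iff
    (fun _ hy => mul_apply_right h₁ h₂ hy.1) ⟨hx, hx'⟩

theorem sameCycle_mul_right (h₁ : SuppIn w₁ a m) (h₂ : SuppIn w₂ (a + m + 1) n) {y : ℕ}
    (hy : (w₁ * w₂).SameCycle (a + m + 1) y) : a + m + 1 ≤ y :=
  (sameCycle_of_eqOn (mul_mem_iff_right h₁ h₂) (fun _ hy => mul_apply_right h₁ h₂ hy.1)
    ⟨le_rfl, by omega⟩ hy).1.1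

theorem IsNCOn.mul (h₁ : IsNCOn w₁ a m) (h₂ : IsNCOn w₂ (a + m + 1) n) :
    IsNCOn (w₁ * w₂) a (m + n + 1) := by
  have hs := supp_mul h₁.supp h₂.supp
  have hlow : ∀ {x}, x ≤ a + m → w₁ x ≤ a + m := by
    intro x hx
    by_cases hxa : a ≤ x
    · exact (h₁.supp.bounds hxa hx).2
    · rw [h₁.supp x (by omega)]
      omega
  have hhigh : ∀ {x}, a + m + 1 ≤ x → a + m + 1 ≤ w₂ x := by
    intro x hx
    by_cases hxa : x ≤ a + m + 1 + n
    · exact (h₂.supp.bounds hx hxa).1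
    · rw [h₂.supp x (by omega)]
      omega
  refine ⟨⟨fun x y h h' => ?_, fun x y h h' => ?_⟩, hs⟩
  · by_cases hx : x ≤ a + m
    · rw [mul_apply_left h₂.supp hx] at h' ⊢
      have := hlow hx
      rw [mul_apply_left h₂.supp (by omega)]
      exact h₁.up x y h h'
    · rw [mul_apply_right h₁.supp h₂.supp (by omega)] at h' ⊢
      rw [mul_apply_right h₁.supp h₂.supp (by omega)]
      exact h₂.up x y h h'
  · by_cases hx : x ≤ a + m
    · rw [mul_apply_left h₂.supp hx] at h ⊢
      rw [mul_apply_left h₂.supp (by omega)]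
      exact h₁.down x y h h'
    · rw [mul_apply_right h₁.supp h₂.supp (by omega)] at h ⊢
      have := hhigh (x := x) (by omega)
      rw [mul_apply_right h₁.supp h₂.supp (by omega)]
      exact h₂.down x y h h'

theorem swap_mul_apply (h₁ : SuppIn w₁ a m) (h₂ : SuppIn w₂ (a + m + 1) n) (ha : w₁ a = a)
    (hl : w₂ (a + m + 1 + n) = a + m + 1) (x : ℕ) :
    (swap a (a + m + 1) * (w₁ * w₂)) x =
      if x = a then a + m + 1 else if x = a + m + 1 + n then a else (w₁ * w₂) x := by
  have ha' : (w₁ * w₂) a = a := by rw [mul_apply_left h₂ (by omega), ha]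
  have hl' : (w₁ * w₂) (a + m + 1 + n) = a + m + 1 := by
    rw [mul_apply_right h₁ h₂ (by omega), hl]
  rw [Perm.mul_apply]
  split_ifs with h h'
  · rw [h, ha', swap_apply_left]
  · rw [h', hl', swap_apply_right]
  · exact swap_apply_of_ne_of_ne (fun e => h ((w₁ * w₂).injective (e.trans ha'.symm)))
      (fun e => h' ((w₁ * w₂).injective (e.trans hl'.symm)))

/-- The transposition puts a in front of the cycle of w₂ through a + m + 1 and the last point.
Nothing crosses, because the other points of the left interval lie under the new arc from a to a + m
+ 1 and w₁ fixes a. -/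
theorem IsNCOn.swap_mul (h₁ : IsNCOn w₁ a m) (h₂ : IsNCOn w₂ (a + m + 1) n) (ha : w₁ a = a)
    (hl : w₂ (a + m + 1 + n) = a + m + 1) :
    IsNCOn (swap a (a + m + 1) * (w₁ * w₂)) a (m + n + 1) := by
  have hs : SuppIn (swap a (a + m + 1) * (w₁ * w₂)) a (m + n + 1) :=
    (SuppIn.swap (by omega) (by omega)).mul (supp_mul h₁.supp h₂.supp)
  have hv := h₁.mul h₂
  have happ := swap_mul_apply h₁.supp h₂.supp ha hl
  have ha' : (w₁ * w₂) a = a := by rw [mul_apply_left h₂.supp (by omega), ha]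
  have hl' : (w₁ * w₂) (a + m + 1 + n) = a + m + 1 := by
    rw [mul_apply_right h₁.supp h₂.supp (by omega), hl]
  have hleft : ∀ y, a < y → y < a + m + 1 → a < (w₁ * w₂) y ∧ (w₁ * w₂) y < a + m + 1 := by
    intro y hy hy'
    rw [mul_apply_left h₂.supp (by omega)]
    have := h₁.supp.bounds (x := y) (by omega) (by omega)
    have hne : w₁ y ≠ a := fun e => by
      have := w₁.injective (e.trans ha.symm)
      omega
    omega
  generalize w₁ * w₂ = v at *
  refine ⟨⟨fun x y h h' => ?_, fun x y h h' => ?_⟩, hs⟩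
  · rw [happ] at h' ⊢
    rw [happ]
    by_cases hxa : x = a
    · rw [if_pos hxa] at h' ⊢
      rw [if_neg (by omega), if_neg (by omega)]
      have := hleft y (by omega) h'
      omega
    · rw [if_neg hxa] at h' ⊢
      by_cases hxl : x = a + m + 1 + n
      · rw [if_pos hxl] at h'
        omega
      · rw [if_neg hxl] at h' ⊢
        have := hv.up x y h h'
        have hya : y ≠ a := by
          rintro rfl
          have := hv.supp x (by omega)
          omega
        have hyl : y ≠ a + m + 1 + n := by
          by_cases hin : a ≤ x ∧ x ≤ a + (m + n + 1)
          · have := hv.supp.bounds hin.1 hin.2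
            omega
          · have := hv.supp x (by omega)
            omega
        rw [if_neg hya, if_neg hyl]
        exact this
  · by_cases hin : a ≤ x ∧ x ≤ a + (m + n + 1)
    swap
    · have := hs x (by omega)
      rw [this] at h ⊢
      obtain rfl : y = x := by omega
      omega
    · rw [happ] at h ⊢
      by_cases hxl : x = a + m + 1 + n
      · rw [if_neg (by omega), if_pos hxl] at h ⊢
        have := hs.bounds h (by omega)
        omega
      · by_cases hxa : x = a
        · rw [if_pos hxa] at h
          omega
        rw [if_neg hxa, if_neg hxl] at h ⊢
        have := hv.down x y h h'
        rw [happ, if_neg, if_neg (by omega)]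
        · exact this
        · rintro rfl
          have := hv.supp.bounds hin.1 hin.2
          have e : v x = y := by omega
          exact hxa (v.injective (e.trans ha'.symm))

theorem longCycle_glue (a m n : ℕ) :
    longCycle a (m + n + 1) =
      swap a (a + m + 1) * (longCycle a m * longCycle (a + m + 1) n) := by
  ext x
  simp only [Perm.mul_apply, longCycle_apply, swap_apply_def]
  split_ifs <;> omega

/-- The long cycle is itself two long cycles joined by the same transposition (`longCycle_glue`),
which cancels: joined permutations have juxtaposed complements. -/
theorem kreweras_swap_mul (h₁ : SuppIn w₁ a m) (h₂ : SuppIn w₂ (a + m + 1) n) :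
    kreweras (swap a (a + m + 1) * (w₁ * w₂)) a (m + n + 1) =
      kreweras w₁ a m * kreweras w₂ (a + m + 1) n := by
  rw [kreweras, longCycle_glue, mul_inv_rev, mul_inv_rev]
  simp only [mul_assoc, inv_mul_cancel_left]
  rw [← mul_assoc w₁⁻¹, ← mul_assoc w₂⁻¹]
  change w₂⁻¹ * kreweras w₁ a m * _ = _
  rw [← mul_comm_of_supp h₁.kreweras h₂.inv, mul_assoc]
  rfl

/-- Here the transposition of the long cycle survives. Moved to the left through (w₁ w₂)⁻¹, which
fixes a and sends a + m + 1 to the last point, it joins the two complements. -/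
theorem kreweras_mul (h₁ : SuppIn w₁ a m) (h₂ : SuppIn w₂ (a + m + 1) n) (ha : w₁ a = a)
    (hl : w₂ (a + m + 1 + n) = a + m + 1) :
    kreweras (w₁ * w₂) a (m + n + 1) =
      swap (a + m + 1 + n) a * (kreweras w₁ a m * kreweras w₂ (a + m + 1) n) := by
  have ha' : (w₁ * w₂)⁻¹ a = a := by
    rw [Perm.inv_eq_iff_eq, mul_apply_left h₂ (by omega), ha]
  have hl' : (w₁ * w₂)⁻¹ (a + m + 1) = a + m + 1 + n := by
    rw [Perm.inv_eq_iff_eq, mul_apply_right h₁ h₂ (by omega), hl]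
  have hc : swap (a + m + 1 + n) a * (w₁ * w₂)⁻¹ = (w₁ * w₂)⁻¹ * swap (a + m + 1) a := by
    rw [mul_swap_eq_swap_mul, ha', hl']
  rw [← kreweras_swap_mul h₁ h₂, kreweras, kreweras, mul_inv_rev (swap _ _), swap_inv, ← mul_assoc,
    ← mul_assoc, hc, swap_comm (a + m + 1) a, mul_assoc (w₁ * w₂)⁻¹, swap_mul_self, mul_one]

end Glue

/-! ### Noncrossing permutations from binary trees -/

mutual
/-- The noncrossing permutation of `[a, a + n]` sending the last point to the first which is
encoded by a binary tree with `n` nodes. -/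
def permA : BinaryTree Unit → ℕ → Perm ℕ
  | .nil, _ => 1
  | .node _ l r, a =>
    swap a (a + l.numNodes + 1) * (permB l a * permA r (a + l.numNodes + 1))
/-- The noncrossing permutation of `[a, a + n]` fixing the first point which is encoded by a
binary tree with `n` nodes. -/
def permB : BinaryTree Unit → ℕ → Perm ℕ
  | .nil, _ => 1
  | .node _ l r, a => permB l a * permA r (a + l.numNodes + 1)
end

theorem one_isNCOn (a : ℕ) : IsNCOn 1 a 0 :=
  ⟨⟨fun x y h h' => by rw [Perm.one_apply] at h'; omega,
    fun x y h h' => by rw [Perm.one_apply] at h; simp only [Perm.one_apply]; omega⟩,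
    fun x _ => rfl⟩

theorem perm_spec (t : BinaryTree Unit) (a : ℕ) :
    (IsNCOn (permA t a) a t.numNodes ∧ permA t a (a + t.numNodes) = a) ∧
      IsNCOn (permB t a) a t.numNodes ∧ permB t a a = a := by
  induction t generalizing a with
  | nil => exact ⟨⟨by rw [permA]; exact one_isNCOn a, by rw [permA]; rfl⟩,
      by rw [permB]; exact one_isNCOn a, by rw [permB]; rfl⟩
  | node _ l r ihl ihr =>
    obtain ⟨-, hl, hl'⟩ := ihl a
    obtain ⟨⟨hr, hr'⟩, -⟩ := ihr (a + l.numNodes + 1)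
    rw [permA, permB, BinaryTree.numNodes]
    refine ⟨⟨hl.swap_mul hr hl' hr', ?_⟩, hl.mul hr, ?_⟩
    · rw [swap_mul_apply hl.supp hr.supp hl' hr', if_neg (by omega), if_pos (by omega)]
    · rw [mul_apply_left hr.supp (by omega), hl']

theorem permA_isNCOn (t : BinaryTree Unit) (a : ℕ) : IsNCOn (permA t a) a t.numNodes :=
  (perm_spec t a).1.1

theorem permA_last (t : BinaryTree Unit) (a : ℕ) : permA t a (a + t.numNodes) = a :=
  (perm_spec t a).1.2

theorem permB_isNCOn (t : BinaryTree Unit) (a : ℕ) : IsNCOn (permB t a) a t.numNodes :=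
  (perm_spec t a).2.1

theorem permB_first (t : BinaryTree Unit) (a : ℕ) : permB t a a = a := (perm_spec t a).2.2

theorem permA_node (u : Unit) (l r : BinaryTree Unit) (a : ℕ) :
    permA (.node u l r) a =
      swap a (a + l.numNodes + 1) * (permB l a * permA r (a + l.numNodes + 1)) := by
  rw [permA]

theorem permB_node (u : Unit) (l r : BinaryTree Unit) (a : ℕ) :
    permB (.node u l r) a = permB l a * permA r (a + l.numNodes + 1) := by
  rw [permB]

/-- Both `permA t a` and the long cycle send the last point to a. -/
theorem krewerasA_last (t : BinaryTree Unit) (a : ℕ) :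
    kreweras (permA t a) a t.numNodes (a + t.numNodes) = a + t.numNodes := by
  apply (permA t a).injective
  rw [apply_kreweras, permA_last, longCycle_apply, if_neg (by omega), if_pos rfl]

theorem krewerasA_node (u : Unit) (l r : BinaryTree Unit) (a : ℕ) :
    kreweras (permA (.node u l r) a) a (BinaryTree.node u l r).numNodes =
      kreweras (permB l a) a l.numNodes *
        kreweras (permA r (a + l.numNodes + 1)) (a + l.numNodes + 1) r.numNodes := by
  rw [permA_node, BinaryTree.numNodes]
  exact kreweras_swap_mul (permB_isNCOn l a).supp (permA_isNCOn r _).supp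

theorem krewerasB_node (u : Unit) (l r : BinaryTree Unit) (a : ℕ) :
    kreweras (permB (.node u l r) a) a (BinaryTree.node u l r).numNodes =
      swap (a + l.numNodes + 1 + r.numNodes) a * (kreweras (permB l a) a l.numNodes *
        kreweras (permA r (a + l.numNodes + 1)) (a + l.numNodes + 1) r.numNodes) := by
  rw [permB_node, BinaryTree.numNodes]
  exact kreweras_mul (permB_isNCOn l a).supp (permA_isNCOn r _).supp (permB_first l a)
    (permA_last r _)

theorem eq_of_mul_eq {w₁ w₂ v₁ v₂ : Perm ℕ} {a m n : ℕ} (h₁ : SuppIn w₁ a m)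
    (h₂ : SuppIn w₂ (a + m + 1) n) (h₁' : SuppIn v₁ a m) (h₂' : SuppIn v₂ (a + m + 1) n)
    (h : w₁ * w₂ = v₁ * v₂) : w₁ = v₁ ∧ w₂ = v₂ := by
  constructor
  · ext x
    by_cases hx : x ≤ a + m
    · rw [← mul_apply_left h₂ hx, h, mul_apply_left h₂' hx]
    · rw [h₁ x (by omega), h₁' x (by omega)]
  · ext x
    by_cases hx : a + m + 1 ≤ x
    · rw [← mul_apply_right h₁ h₂ hx, h, mul_apply_right h₁' h₂' hx]
    · rw [h₂ x (by omega), h₂' x (by omega)]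

/-- The size of the left subtree can be read off the permutation: the split point a + l.numNodes + 1
is the image of a under `permA` and of the last point under `permB`. Disjoint supports then separate
the two factors. -/
theorem perm_injective (t : BinaryTree Unit) : ∀ (t' : BinaryTree Unit) (a : ℕ),
    t.numNodes = t'.numNodes →
      (permA t a = permA t' a → t = t') ∧ (permB t a = permB t' a → t = t') := by
  induction t with
  | nil =>
    intro t' a h
    cases t' with
    | nil => simp
    | node _ l r => simp at h
  | node u l r ihl ihr =>
    intro t' a h
    cases t' with
    | nil => simp at h
    | node u' l' r' =>
      simp only [BinaryTree.numNodes] at h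
      have fin : permB l a * permA r (a + l.numNodes + 1) =
          permB l' a * permA r' (a + l'.numNodes + 1) → l.numNodes = l'.numNodes →
          BinaryTree.node u l r = BinaryTree.node u' l' r' := by
        intro e hn
        rw [← hn] at e
        have hb := permB_isNCOn l' a
        rw [← hn] at hb
        have hr : r.numNodes = r'.numNodes := by omega
        have ha := permA_isNCOn r' (a + l.numNodes + 1)
        rw [← hr] at ha
        obtain ⟨e₁, e₂⟩ := eq_of_mul_eq (permB_isNCOn l a).supp (permA_isNCOn r _).supp
          hb.supp ha.supp e
        rw [(ihl l' a hn).2 e₁, (ihr r' _ hr).1 e₂]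
      constructor
      · intro e
        rw [permA_node, permA_node] at e
        have ea := congrArg (fun w => w a) e
        simp only [swap_mul_apply (permB_isNCOn _ a).supp (permA_isNCOn _ _).supp
          (permB_first _ _) (permA_last _ _), if_true] at ea
        have hn : l.numNodes = l'.numNodes := by omega
        refine fin ?_ hn
        rw [← hn] at e ⊢
        exact mul_left_cancel e
      · intro e
        rw [permB_node, permB_node] at e
        refine fin e ?_
        have ea := congrArg (fun w => w (a + l.numNodes + 1 + r.numNodes)) e
        have en : a + l.numNodes + 1 + r.numNodes = a + l'.numNodes + 1 + r'.numNodes := by omega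
        rw [mul_apply_right (permB_isNCOn _ a).supp (permA_isNCOn _ _).supp (by omega),
          permA_last, en,
          mul_apply_right (permB_isNCOn _ a).supp (permA_isNCOn _ _).supp (by omega),
          permA_last] at ea
        omega

end NCPerm

-- Decoding noncrossing permutations into binary trees

namespace NCPerm

open Equiv

theorem IsNC.exists_restrict {w : Perm ℕ} (hw : IsNC w) {p q : ℕ}
    (h : ∀ x, p ≤ x → x ≤ q → p ≤ w x ∧ w x ≤ q) :
    ∃ v : Perm ℕ, IsNC v ∧ ∀ x, v x = if p ≤ x ∧ x ≤ q then w x else x := by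
  have hinv : ∀ x, p ≤ x → x ≤ q → p ≤ w⁻¹ x ∧ w⁻¹ x ≤ q := fun x => inv_mem_of_maps h
  let v : Perm ℕ :=
    { toFun := fun x => if p ≤ x ∧ x ≤ q then w x else x
      invFun := fun x => if p ≤ x ∧ x ≤ q then w⁻¹ x else x
      left_inv := fun x => by
        dsimp only
        by_cases hx : p ≤ x ∧ x ≤ q
        · rw [if_pos hx, if_pos (h x hx.1 hx.2), inv_apply_apply]
        · rw [if_neg hx, if_neg hx]
      right_inv := fun x => by
        dsimp only
        by_cases hx : p ≤ x ∧ x ≤ q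
        · rw [if_pos hx, if_pos (hinv x hx.1 hx.2), apply_inv_apply]
        · rw [if_neg hx, if_neg hx] }
  have hv : ∀ x, v x = if p ≤ x ∧ x ≤ q then w x else x := fun x => rfl
  clear_value v
  refine ⟨v, ⟨fun x y hxy hy => ?_, fun x y hxy hy => ?_⟩, hv⟩
  · by_cases hx : p ≤ x ∧ x ≤ q
    · have := h x hx.1 hx.2
      rw [hv, if_pos hx] at hy
      rw [hv x, if_pos hx, hv y, if_pos (by omega)]
      exact hw.up x y hxy hy
    · rw [hv, if_neg hx] at hy
      omega
  · by_cases hx : p ≤ x ∧ x ≤ q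
    · have := h x hx.1 hx.2
      rw [hv, if_pos hx] at hxy
      rw [hv x, if_pos hx, hv y, if_pos (by omega)]
      exact hw.down x y hxy hy
    · rw [hv, if_neg hx] at hxy ⊢
      obtain rfl : y = x := by omega
      rw [hv, if_neg hx]
      omega

theorem SuppIn.eq_one {w : Perm ℕ} {a : ℕ} (h : SuppIn w a 0) : w = 1 := by
  ext x
  by_cases hx : x = a
  · have := h.bounds (x := x) (by omega) (by omega)
    rw [Perm.one_apply]
    omega
  · rw [h x (by omega), Perm.one_apply]

/-- The split point is w a. The interval strictly under the arc from a to w a is stable and gives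
w₁; deleting a from its cycle leaves w₂ on the rest. -/
theorem IsNCOn.exists_splitA {w : Perm ℕ} {a n : ℕ} (hw : IsNCOn w a n) (hn : 0 < n)
    (hl : w (a + n) = a) : ∃ m k w₁ w₂, n = m + k + 1 ∧ IsNCOn w₁ a m ∧ w₁ a = a ∧
      IsNCOn w₂ (a + m + 1) k ∧ w₂ (a + m + 1 + k) = a + m + 1 ∧
      w = swap a (a + m + 1) * (w₁ * w₂) := by
  have hb := hw.supp.bounds (x := a) le_rfl (by omega)
  have hne : w a ≠ a := fun e => by
    have := w.injective (e.trans hl.symm)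
    omega
  obtain ⟨m, hm⟩ : ∃ m, w a = a + m + 1 := ⟨w a - a - 1, by omega⟩
  obtain ⟨k, rfl⟩ : ∃ k, n = m + k + 1 := ⟨n - m - 1, by omega⟩
  have hmaps : ∀ x, a + 1 ≤ x → x ≤ a + m → a + 1 ≤ w x ∧ w x ≤ a + m := fun x h1 h2 => by
    have := hw.up a x (by omega) (by omega)
    omega
  obtain ⟨w₁, h₁, hv₁⟩ := hw.toIsNC.exists_restrict hmaps
  have ha₁ : w₁ a = a := by rw [hv₁, if_neg (by omega)]
  set b := a + m + 1 with hbdef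
  have hwa : ∀ x, w x = a → x = a + (m + k + 1) := fun x e => w.injective (e.trans hl.symm)
  have hwb : ∀ x, w x = b → x = a := fun x e => w.injective (e.trans hm.symm)
  -- Only the last point of [b, a + n] can land at or below b: a is hit by the last point alone, b
  -- by a alone, and values in between come from the stable interval.
  have hge : ∀ x, b ≤ x → x ≠ a + (m + k + 1) → b < w x := by
    intro x hx hxl
    have h1 : w x ≠ a := fun e => hxl (hwa x e)
    have h2 : w x ≠ b := fun e => by
      have := hwb x e
      omega
    by_cases hxn : x ≤ a + (m + k + 1)
    · have := hw.supp.bounds (x := x) (by omega) hxn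
      by_contra hc
      have := inv_mem_of_maps hmaps (x := w x) (by omega) (by omega)
      rw [inv_apply_apply] at this
      omega
    · rw [hw.supp x (by omega)] at h2 ⊢
      omega
  -- Defined so that the factorization holds at once; only its pointwise values remain to be
  -- computed.
  let w₂ := w₁⁻¹ * (swap a b * w)
  have hv₂ : ∀ x, w₂ x = if x < b then x else if x = a + (m + k + 1) then b else w x := by
    intro x
    change w₁⁻¹ (swap a b (w x)) = _
    rw [Perm.inv_eq_iff_eq]
    split_ifs with h h'
    · rw [hv₁]
      by_cases hxa : x = a
      · rw [if_neg (by omega), hxa, hm, swap_apply_right]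
      · by_cases hx : a + 1 ≤ x
        · have := hmaps x hx (by omega)
          rw [if_pos (by omega), swap_apply_of_ne_of_ne (by omega) (by omega)]
        · rw [if_neg (by omega), hw.supp x (by omega),
            swap_apply_of_ne_of_ne (by omega) (by omega)]
    · rw [h', hl, swap_apply_left, hv₁, if_neg (by omega)]
    · have := hge x (by omega) h'
      rw [hv₁, if_neg (by omega), swap_apply_of_ne_of_ne (by omega) (by omega)]
  have hw_eq : w = swap a b * (w₁ * w₂) := by
    simp only [w₂, mul_inv_cancel_left, swap_mul_self_mul]
  clear_value w₂
  have hs₂ : SuppIn w₂ b k := by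
    intro x hx
    rw [hv₂]
    split_ifs with h h'
    · rfl
    · omega
    · exact hw.supp x (by omega)
  refine ⟨m, k, w₁, w₂, rfl, ⟨h₁, fun x hx => ?_⟩, ha₁, ⟨⟨fun x y h h' => ?_, fun x y h h' => ?_⟩,
    hs₂⟩, ?_, hw_eq⟩
  · rw [hv₁, if_neg (by omega)]
  · have hxb : ¬ x < b := fun hc => by
      rw [hv₂, if_pos hc] at h'
      omega
    by_cases hxl : x = a + (m + k + 1)
    · rw [hv₂, if_neg hxb, if_pos hxl] at h'
      omega
    · rw [hv₂ x, if_neg hxb, if_neg hxl] at h' ⊢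
      have hyl : y ≠ a + (m + k + 1) := by
        have := hw.supp.bounds (x := x) (by omega)
        have := hw.supp x
        omega
      rw [hv₂, if_neg (by omega), if_neg hyl]
      exact hw.up x y h h'
  · by_cases hin : b ≤ x ∧ x ≤ b + k
    · have hbx := hs₂.bounds hin.1 hin.2
      by_cases hxl : x = a + (m + k + 1)
      · rw [hv₂ x, if_neg (by omega), if_pos hxl] at h ⊢
        have := hs₂.bounds h (by omega)
        omega
      · have e : w₂ x = w x := by rw [hv₂, if_neg (by omega), if_neg hxl]
        rw [e] at h hbx ⊢
        rw [hv₂ y, if_neg (by omega), if_neg (by omega)]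
        exact hw.down x y h h'
    · have := hs₂ x (by omega)
      rw [this] at h ⊢
      obtain rfl : y = x := by omega
      omega
  · rw [hv₂, if_neg (by omega), if_pos (by omega)]

/-- The split point is the image of the last point: `down` makes the interval from it to the last
point stable, hence also the remaining interval on the left. -/
theorem IsNCOn.exists_splitB {w : Perm ℕ} {a n : ℕ} (hw : IsNCOn w a n) (hn : 0 < n)
    (ha : w a = a) : ∃ m k w₁ w₂, n = m + k + 1 ∧ IsNCOn w₁ a m ∧ w₁ a = a ∧
      IsNCOn w₂ (a + m + 1) k ∧ w₂ (a + m + 1 + k) = a + m + 1 ∧ w = w₁ * w₂ := by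
  have hb := hw.supp.bounds (x := a + n) (by omega) le_rfl
  have hne : w (a + n) ≠ a := fun e => by
    have := w.injective (e.trans ha.symm)
    omega
  obtain ⟨m, hm⟩ : ∃ m, w (a + n) = a + m + 1 := ⟨w (a + n) - a - 1, by omega⟩
  obtain ⟨k, rfl⟩ : ∃ k, n = m + k + 1 := ⟨n - m - 1, by omega⟩
  have hmaps₂ : ∀ x, a + m + 1 ≤ x → x ≤ a + m + 1 + k →
      a + m + 1 ≤ w x ∧ w x ≤ a + m + 1 + k := fun x h1 h2 => by
    have := hw.down (a + (m + k + 1)) x (by omega) (by omega)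
    omega
  have hmaps₁ : ∀ x, a ≤ x → x ≤ a + m → a ≤ w x ∧ w x ≤ a + m := fun x h1 h2 => by
    have := hw.supp.bounds h1 (by omega)
    refine ⟨this.1, ?_⟩
    by_contra hc
    have := inv_mem_of_maps hmaps₂ (x := w x) (by omega) (by omega)
    rw [inv_apply_apply] at this
    omega
  obtain ⟨w₁, h₁, hv₁⟩ := hw.toIsNC.exists_restrict hmaps₁
  obtain ⟨w₂, h₂, hv₂⟩ := hw.toIsNC.exists_restrict hmaps₂
  have hs₁ : SuppIn w₁ a m := fun x hx => by rw [hv₁, if_neg (by omega)]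
  have hs₂ : SuppIn w₂ (a + m + 1) k := fun x hx => by rw [hv₂, if_neg (by omega)]
  refine ⟨m, k, w₁, w₂, rfl, ⟨h₁, hs₁⟩, ?_, ⟨h₂, hs₂⟩, ?_, ?_⟩
  · rw [hv₁, if_pos (by omega), ha]
  · rw [hv₂, if_pos (by omega), ← hm]
    congr 1
    omega
  · ext x
    by_cases hx : x ≤ a + m
    · rw [mul_apply_left hs₂ hx, hv₁]
      split_ifs
      · rfl
      · exact hw.supp x (by omega)
    · rw [mul_apply_right hs₁ hs₂ (by omega), hv₂]
      split_ifs
      · rfl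
      · exact hw.supp x (by omega)

theorem exists_tree (n : ℕ) : ∀ (a : ℕ) (w : Perm ℕ), IsNCOn w a n →
    (w (a + n) = a → ∃ t : BinaryTree Unit, t.numNodes = n ∧ permA t a = w) ∧
      (w a = a → ∃ t : BinaryTree Unit, t.numNodes = n ∧ permB t a = w) := by
  induction n using Nat.strong_induction_on with
  | _ n ih =>
    intro a w hw
    rcases Nat.eq_zero_or_pos n with rfl | hn
    · have := hw.supp.eq_one
      exact ⟨fun _ => ⟨.nil, rfl, by rw [permA, this]⟩, fun _ => ⟨.nil, rfl, by rw [permB, this]⟩⟩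
    · constructor
      · intro hl
        obtain ⟨m, k, w₁, w₂, rfl, h₁, ha', h₂, hl', rfl⟩ := hw.exists_splitA hn hl
        obtain ⟨l, rfl, rfl⟩ := (ih m (by omega) a w₁ h₁).2 ha'
        obtain ⟨r, rfl, rfl⟩ := (ih k (by omega) _ w₂ h₂).1 hl'
        exact ⟨.node () l r, rfl, permA_node _ _ _ _⟩
      · intro ha
        obtain ⟨m, k, w₁, w₂, rfl, h₁, ha', h₂, hl', rfl⟩ := hw.exists_splitB hn ha
        obtain ⟨l, rfl, rfl⟩ := (ih m (by omega) a w₁ h₁).2 ha'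
        obtain ⟨r, rfl, rfl⟩ := (ih k (by omega) _ w₂ h₂).1 hl'
        exact ⟨.node () l r, rfl, permB_node _ _ _ _⟩

/-! ### Products over cycles and their recursion along binary trees -/

/-- The ordered product of `X (rho w x)` over the `k` points starting with `a`. -/
def word {E : Type*} [Monoid E] (X : ℕ → E) (w : Perm ℕ) (a k : ℕ) : E :=
  ((List.range' a k).map fun x => X (rho w x)).prod

section Word

variable {E : Type*} [Monoid E] (X : ℕ → E)

theorem word_add (w : Perm ℕ) (a k l : ℕ) :
    word X w a (k + l) = word X w a k * word X w (a + k) l := by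
  rw [word, word, word, ← List.prod_append, ← List.map_append, List.range'_append_1]

theorem word_one (w : Perm ℕ) (a : ℕ) : word X w a 1 = X (rho w a) := by
  simp [word]

theorem word_succ (w : Perm ℕ) (a k : ℕ) :
    word X w a (k + 1) = X (rho w a) * word X w (a + 1) k := by
  rw [add_comm, word_add, word_one]

theorem word_congr {w v : Perm ℕ} {a k : ℕ} (h : ∀ x, a ≤ x → x < a + k → rho w x = rho v x) :
    word X w a k = word X v a k := by
  rw [word, word]
  congr 1
  refine List.map_congr_left fun x hx => ?_
  rw [List.mem_range'_1] at hx
  rw [h x hx.1 hx.2]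

/-- The length of the rightmost branch of a binary tree. -/
def heightA : BinaryTree Unit → ℕ
  | .nil => 0
  | .node _ _ r => heightA r + 1

/-- The length of the leftmost branch of a binary tree. -/
def heightB : BinaryTree Unit → ℕ
  | .nil => 0
  | .node _ l _ => heightB l + 1

mutual
/-- The product over the cycles of `permA t a` that avoid `a`. -/
def xA : BinaryTree Unit → E
  | .nil => 1
  | .node _ l r => xB l * xA r
/-- The product over the cycles of `permB t a`. -/
def xB : BinaryTree Unit → E
  | .nil => 1
  | .node _ l r => xB l * (X (heightA r) * xA r)
end

mutual
/-- The product over the cycles of the Kreweras complement of `permA t a`. -/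
def yA : BinaryTree Unit → E
  | .nil => 1
  | .node _ l r => X (heightB l) * yB l * yA r
/-- The product over the cycles of the Kreweras complement of `permB t a` that avoid `a`. -/
def yB : BinaryTree Unit → E
  | .nil => 1
  | .node _ l r => yB l * yA r
end

theorem SuppIn.min_first {w : Perm ℕ} {a n : ℕ} (h : SuppIn w a n) (y : ℕ)
    (hy : w.SameCycle a y) : a ≤ y := (h.sameCycle le_rfl (by omega) hy).1

variable {X}

/-- Each node of the right branch inserts one point in front of the cycle of the first point of its
right subtree. -/
theorem rho_permA (t : BinaryTree Unit) (a : ℕ) : rho (permA t a) a = heightA t := by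
  induction t generalizing a with
  | nil => exact rho_of_fixed (by rw [permA]; rfl)
  | node u l r _ ihr =>
    have hl := permB_isNCOn l a
    have hr := permA_isNCOn r (a + l.numNodes + 1)
    have hs := supp_mul hl.supp hr.supp
    have := rho_insert_min (q := a) (z := a + l.numNodes + 1)
      (v := permB l a * permA r (a + l.numNodes + 1))
      (by rw [mul_apply_left hr.supp (by omega), permB_first]) (by omega)
      (fun y => sameCycle_mul_right hl.supp hr.supp)
      (hs.finite (by omega) (by omega))
    rw [min_eq_left (by omega)] at this
    rw [permA_node, this, rho_mul_right hl.supp hr.supp le_rfl (by omega), ihr, heightA]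

/-- Dually, each node of the left branch appends its last point to the complementary cycle of a. -/
theorem rho_krewerasB (t : BinaryTree Unit) (a : ℕ) :
    rho (kreweras (permB t a) a t.numNodes) a = heightB t := by
  induction t generalizing a with
  | nil =>
    refine rho_of_fixed ?_
    have := (permB_isNCOn .nil a).supp.kreweras.bounds (x := a) le_rfl (by omega)
    rw [BinaryTree.numNodes] at this ⊢
    omega
  | node u l r ihl _ =>
    have hl := (permB_isNCOn l a).supp.kreweras
    have hr := (permA_isNCOn r (a + l.numNodes + 1)).supp.kreweras
    have hs := supp_mul hl hr
    have := rho_insert_min (q := a + l.numNodes + 1 + r.numNodes) (z := a)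
      (by rw [mul_apply_right hl hr (by omega), krewerasA_last]) (by omega)
      (fun y => hs.min_first y) (hs.finite (by omega) (by omega))
    rw [min_eq_right (by omega)] at this
    rw [krewerasB_node, this, rho_mul_left hl hr (by omega) (by omega), ihl, heightB]

/-- The two cases differ only at the split point. In `permB` it is the minimum of the right-hand
root cycle and contributes `X (heightA r)`; in `permA` it has joined the cycle of a and contributes
`X 0 = 1`. -/
theorem word_perm (hX : X 0 = 1) (t : BinaryTree Unit) (a : ℕ) :
    word X (permA t a) (a + 1) t.numNodes = xA X t ∧
      word X (permB t a) (a + 1) t.numNodes = xB X t := by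
  induction t generalizing a with
  | nil => simp [word, xA, xB]
  | node u l r ihl ihr =>
    have hl := permB_isNCOn l a
    have hr := permA_isNCOn r (a + l.numNodes + 1)
    have hs := supp_mul hl.supp hr.supp
    have ha : (permB l a * permA r (a + l.numNodes + 1)) a = a := by
      rw [mul_apply_left hr.supp (by omega), permB_first]
    have hB₁ : ∀ x, a + 1 ≤ x → x < a + 1 + l.numNodes →
        rho (permB (.node u l r) a) x = rho (permB l a) x := fun x h1 h2 => by
      rw [permB_node, rho_mul_left hl.supp hr.supp (by omega) (by omega)]
    have hB₂ : ∀ x, a + l.numNodes + 1 ≤ x → x < a + l.numNodes + 1 + (r.numNodes + 1) →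
        rho (permB (.node u l r) a) x = rho (permA r (a + l.numNodes + 1)) x :=
      fun x h1 h2 => by
        rw [permB_node, rho_mul_right hl.supp hr.supp (by omega) (by omega)]
    have hA : ∀ x, a + 1 ≤ x → x ≠ a + l.numNodes + 1 →
        rho (permA (.node u l r) a) x = rho (permB (.node u l r) a) x := fun x h1 h2 => by
      rw [permA_node, permB_node, rho_insert_of_ne ha (by omega)
        (fun y => sameCycle_mul_right hl.supp hr.supp) (by omega) h2]
    have hA₀ : rho (permA (.node u l r) a) (a + l.numNodes + 1) = 0 := by
      have := rho_insert_max (q := a) (z := a + l.numNodes + 1) ha (by omega)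
      rwa [max_eq_right (by omega), ← permA_node u] at this
    have e : (BinaryTree.node u l r).numNodes = l.numNodes + (r.numNodes + 1) := rfl
    have e' : a + 1 + l.numNodes = a + l.numNodes + 1 := by omega
    have hw : ∀ v, word X v (a + 1) (BinaryTree.node u l r).numNodes =
        word X v (a + 1) l.numNodes * word X v (a + l.numNodes + 1) (r.numNodes + 1) := by
      intro v
      rw [e, word_add, e']
    rw [hw, hw, xA, xB]
    constructor
    · rw [← (ihl a).2, ← (ihr (a + l.numNodes + 1)).1, word_succ, hA₀, hX, one_mul]
      congr 1
      · exact word_congr X fun x h1 h2 => by rw [hA x h1 (by omega), hB₁ x h1 h2]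
      · exact word_congr X fun x h1 h2 => by
          rw [hA x (by omega) (by omega), hB₂ x (by omega) (by omega)]
    · rw [← (ihl a).2, ← (ihr (a + l.numNodes + 1)).1, ← rho_permA r (a + l.numNodes + 1),
        ← word_succ]
      congr 1
      · exact word_congr X hB₁
      · exact word_congr X hB₂

/-- Past a, the two complements have the same `rho`: they differ by inserting the last point into
the cycle of a, and that point contributes 1 both as a fixed point and as a non-minimum. -/
theorem word_kreweras (hX : X 0 = 1) (t : BinaryTree Unit) (a : ℕ) :
    word X (kreweras (permA t a) a t.numNodes) a (t.numNodes + 1) = yA X t ∧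
      word X (kreweras (permB t a) a t.numNodes) (a + 1) t.numNodes = yB X t := by
  induction t generalizing a with
  | nil =>
    have : rho (kreweras (permA .nil a) a 0) a = 0 := rho_of_fixed (krewerasA_last .nil a)
    simp [word, yA, yB, this, hX]
  | node u l r ihl ihr =>
    have hl := (permB_isNCOn l a).supp.kreweras
    have hr := (permA_isNCOn r (a + l.numNodes + 1)).supp.kreweras
    have hs := supp_mul hl hr
    have hlast := krewerasA_last r (a + l.numNodes + 1)
    have hq := hlast
    rw [← mul_apply_right hl hr (by omega)] at hq
    have hA₁ : ∀ x, a ≤ x → x < a + (l.numNodes + 1) →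
        rho (kreweras (permA (.node u l r) a) a (BinaryTree.node u l r).numNodes) x =
          rho (kreweras (permB l a) a l.numNodes) x := fun x h1 h2 => by
      rw [krewerasA_node, rho_mul_left hl hr (by omega) (by omega)]
    have hA₂ : ∀ x, a + l.numNodes + 1 ≤ x → x < a + l.numNodes + 1 + (r.numNodes + 1) →
        rho (kreweras (permA (.node u l r) a) a (BinaryTree.node u l r).numNodes) x =
          rho (kreweras (permA r (a + l.numNodes + 1)) (a + l.numNodes + 1) r.numNodes) x :=
      fun x h1 h2 => by
        rw [krewerasA_node, rho_mul_right hl hr (by omega) (by omega)]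
    have hB : ∀ x, a + 1 ≤ x → x < a + l.numNodes + 1 + (r.numNodes + 1) →
        rho (kreweras (permB (.node u l r) a) a (BinaryTree.node u l r).numNodes) x =
          rho (kreweras (permA (.node u l r) a) a (BinaryTree.node u l r).numNodes) x :=
      fun x h1 h2 => by
        by_cases hx : x = a + l.numNodes + 1 + r.numNodes
        · have := rho_insert_max (q := a + l.numNodes + 1 + r.numNodes) (z := a) hq (by omega)
          rw [max_eq_left (by omega)] at this
          rw [hA₂ x (by omega) (by omega), krewerasB_node, hx, this, rho_of_fixed hlast]
        · rw [krewerasB_node, krewerasA_node, rho_insert_of_ne hq (by omega)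
            (fun y => hs.min_first y) hx (by omega)]
    have e : (BinaryTree.node u l r).numNodes = l.numNodes + 1 + r.numNodes := by
      rw [BinaryTree.numNodes]; omega
    constructor
    · have e₁ : (BinaryTree.node u l r).numNodes + 1 = l.numNodes + 1 + (r.numNodes + 1) := by
        omega
      rw [e₁, word_add, yA, ← (ihl a).2, ← (ihr (a + l.numNodes + 1)).1, ← rho_krewerasB l a,
        ← word_succ]
      congr 1
      · exact word_congr X hA₁
      · exact word_congr X hA₂
    · have e₁ : (BinaryTree.node u l r).numNodes = l.numNodes + (r.numNodes + 1) := by omega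
      have e' : a + 1 + l.numNodes = a + l.numNodes + 1 := by omega
      have hw : ∀ v, word X v (a + 1) (BinaryTree.node u l r).numNodes =
          word X v (a + 1) l.numNodes * word X v (a + l.numNodes + 1) (r.numNodes + 1) := by
        intro v
        rw [e₁, word_add, e']
      rw [hw, yB, ← (ihl a).2, ← (ihr (a + l.numNodes + 1)).1]
      congr 1
      · exact word_congr X fun x h1 h2 => by rw [hB x h1 (by omega), hA₁ x (by omega) (by omega)]
      · exact word_congr X fun x h1 h2 => by rw [hB x (by omega) h2, hA₂ x h1 h2]

end Word

end NCPerm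

/-! ## Set partitions and noncrossing permutations -/

namespace SetPartition

open Equiv NCPerm

variable {m : ℕ}

/-- `y` is the cyclic successor of `x` in the finite set `B`. -/
def IsNext (B : Finset (Fin m)) (x y : Fin m) : Prop :=
  y ∈ B ∧ ((x < y ∧ ∀ z ∈ B, z ≤ x ∨ y ≤ z) ∨ ∀ z ∈ B, y ≤ z ∧ z ≤ x)

theorem IsNext.unique {B : Finset (Fin m)} {x y y' : Fin m}
    (h : IsNext B x y) (h' : IsNext B x y') : y = y' := by
  obtain ⟨hy, h⟩ := h
  obtain ⟨hy', h'⟩ := h'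
  rcases h with ⟨hlt, h⟩ | h <;> rcases h' with ⟨hlt', h'⟩ | h'
  · have := h y' hy'
    have := h' y hy
    omega
  · have := h' y hy
    omega
  · have := h y' hy'
    omega
  · have := h y' hy'
    have := h' y hy
    omega

theorem isNext_blockCycle {B : Finset (Fin m)} {x : Fin m} (hx : x ∈ B) :
    IsNext B x (blockCycle B x) := by
  have hs := B.sortedLT_sort
  rw [blockCycle]
  have hmem : ∀ z, z ∈ B ↔ z ∈ B.sort (· ≤ ·) := fun z => (Finset.mem_sort _).symm
  have hx' := (hmem x).1 hx
  simp only [IsNext, hmem]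
  generalize B.sort (· ≤ ·) = l at *
  obtain ⟨i, hi, rfl⟩ := List.getElem_of_mem hx'
  rw [List.formPerm_apply_getElem _ hs.nodup]
  refine ⟨List.getElem_mem _, ?_⟩
  rcases Nat.lt_or_ge (i + 1) l.length with hlt | hge
  · left
    simp only [Nat.mod_eq_of_lt hlt]
    refine ⟨hs.getElem_lt_getElem_of_lt (Nat.lt_succ_self i), fun z hz => ?_⟩
    obtain ⟨j, hj, rfl⟩ := List.getElem_of_mem hz
    rw [hs.getElem_le_getElem_iff, hs.getElem_le_getElem_iff]
    omega
  · right
    have : i + 1 = l.length := by omega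
    simp only [this, Nat.mod_self]
    intro z hz
    obtain ⟨j, hj, rfl⟩ := List.getElem_of_mem hz
    rw [hs.getElem_le_getElem_iff, hs.getElem_le_getElem_iff]
    omega

theorem mem_part_self (π : SetPartition m) (x : Fin m) : x ∈ π.part x :=
  π.mem_part (Finset.mem_univ x)

theorem isNext_toPerm (π : SetPartition m) (x : Fin m) : IsNext (π.part x) x (π.toPerm x) :=
  isNext_blockCycle (π.mem_part_self x)

theorem mem_part_iff (π : SetPartition m) {x y : Fin m} : y ∈ π.part x ↔ π.part y = π.part x :=
  ⟨fun h => π.part_eq_of_mem (by simp) h, fun h => h ▸ π.mem_part_self y⟩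

theorem sameCycle_toPerm (π : SetPartition m) {x y : Fin m} :
    π.toPerm.SameCycle x y ↔ y ∈ π.part x := by
  constructor
  · intro h
    rw [mem_part_iff]
    refine (sameCycle_le (r := fun x y => π.part x = π.part y)
      ⟨fun _ => rfl, Eq.symm, Eq.trans⟩ (fun x => ?_) h).symm
    exact (part_blockCycle π x).symm
  · intro hy
    have hnd := (π.part x).sort_nodup (· ≤ ·)
    have hcyc := hnd.isCycleOn_formPerm
    have hsc : (blockCycle (π.part x)).SameCycle x y :=
      hcyc.2 (by simp) (by simpa using hy)
    refine (sameCycle_of_eqOn (s := (π.part x : Set (Fin m))) (fun z => ?_) (fun z hz => ?_)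
      (π.mem_part_self x) hsc).2
    · rw [Finset.mem_coe, Finset.mem_coe, ← Finset.mem_sort (· ≤ ·),
        ← Finset.mem_sort (s := π.part x) (· ≤ ·)]
      exact ⟨List.mem_of_formPerm_apply_mem, List.formPerm_apply_mem_of_mem⟩
    · have := (π.mem_part_iff).1 (Finset.mem_coe.1 hz)
      change _ = blockCycle (π.part z) z
      rw [this]

/-- No element of the block of x lies strictly between x and w x when x < w x; otherwise w x is the
minimum and x the maximum of the block. A different block leaving or entering the interval between x
and w x would cross this block. -/
theorem IsNoncrossing.isNC {π : SetPartition m} (h : π.IsNoncrossing) : IsNC π.toPerm := by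
  have hcross : ∀ a b c d : Fin m, c ∈ π.part a → d ∈ π.part b → b ∉ π.part a →
      a < b → b < c → c < d → False := by
    intro a b c d hc hd hb h1 h2 h3
    refine h (π.part a) (by simp) (π.part b) (by simp) (fun e => hb ?_) a
      (π.mem_part_self a) b (π.mem_part_self b) c hc d hd ⟨h1, h2, h3⟩
    rw [e]
    exact π.mem_part_self b
  have hnext := π.isNext_toPerm
  have hne : ∀ {x y}, y ∉ π.part x → π.toPerm y ∉ π.part x := by
    intro x y hy hc
    rw [mem_part_iff] at hy hc
    exact hy ((π.mem_part_iff.1 (hnext y).1).symm.trans hc)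
  have hsymm : ∀ {x y}, y ∈ π.part x → x ∈ π.part y := fun h => by
    rw [mem_part_iff] at h ⊢
    exact h.symm
  constructor
  · intro x y hxy hy
    have hx := hnext x
    obtain ⟨hwx, ⟨-, hx⟩ | hx⟩ := hx
    swap
    · have := hx _ (π.mem_part_self x)
      omega
    have hynot : y ∉ π.part x := fun hc => by
      have := hx y hc
      omega
    have hwy := (hnext y).1
    have hwynot := hne hynot
    have h1 : π.toPerm y ≠ x := fun e => hwynot (e ▸ π.mem_part_self x)
    have h2 : π.toPerm y ≠ π.toPerm x := fun e => hwynot (e ▸ hwx)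
    constructor
    · by_contra hc
      refine hcross (π.toPerm y) x y (π.toPerm x) (hsymm hwy) hwx ?_ (by omega) hxy hy
      intro hcon
      exact hwynot (hsymm hcon)
    · by_contra hc
      exact hcross x y (π.toPerm x) (π.toPerm y) hwx hwy hynot hxy hy (by omega)
  · intro x y hxy hy
    obtain ⟨hwx, ⟨hx', hx⟩ | hx⟩ := hnext x
    · omega
    by_cases hyx : y ∈ π.part x
    · have := (π.mem_part_iff.1 hyx) ▸ (hnext y).1
      exact hx _ this
    have hwy := (hnext y).1
    have hwynot := hne hyx
    have h1 : π.toPerm y ≠ x := fun e => hwynot (e ▸ π.mem_part_self x)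
    have h2 : y ≠ x := fun e => hyx (e ▸ π.mem_part_self x)
    have h3 : y ≠ π.toPerm x := fun e => hyx (e ▸ hwx)
    constructor
    · by_contra hc
      refine hcross (π.toPerm y) (π.toPerm x) y x (hsymm hwy) (hsymm hwx) ?_ (by omega)
        (by omega) (by omega)
      intro hcon
      refine hwynot ?_
      rw [mem_part_iff] at hcon hwx ⊢
      exact hcon.symm.trans hwx
    · by_contra hc
      refine hcross (π.toPerm x) y x (π.toPerm y) (hsymm hwx) hwy ?_ (by omega)
        (by omega) (by omega)
      intro hcon
      refine hyx ?_
      rw [mem_part_iff] at hcon hwx ⊢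
      exact hcon.trans hwx

-- The blocks are the cycles of w. The intervals in `IsNC` are finite and stable, so they contain
-- the whole cycle of each of their points; this forces w x to be the cyclic successor of x and
-- excludes crossings.
open Classical in
theorem _root_.NCPerm.IsNC.exists_setPartition {w : Perm (Fin m)} (hw : IsNC w) :
    ∃ π : SetPartition m, π.IsNoncrossing ∧ π.toPerm = w := by
  let π : SetPartition m := Finpartition.ofSetoid (Perm.SameCycle.setoid w)
  have hpart : ∀ {x y}, y ∈ π.part x ↔ w.SameCycle x y := by
    intro x y
    exact Finpartition.mem_part_ofSetoid_iff_rel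
  have hup : ∀ {x y z : Fin m}, x < y → y < w x → w.SameCycle y z → x < z ∧ z < w x := by
    intro x y z hy hy' h
    have hmaps : ∀ u ∈ Finset.Ioo x (w x), w u ∈ Finset.Ioo x (w x) := fun u hu => by
      rw [Finset.mem_Ioo] at hu ⊢
      exact hw.up x u hu.1 hu.2
    have := sameCycle_of_eqOn (w := w) (v := w) (s := Finset.Ioo x (w x)) (fun u => ?_)
      (fun _ _ => rfl) (by simpa using ⟨hy, hy'⟩) h
    · simpa using this.1
    · refine ⟨fun hu => ?_, hmaps u⟩
      obtain ⟨v, hv, e⟩ := Finset.surjOn_of_injOn_of_card_le w hmaps w.injective.injOn le_rfl hu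
      rwa [← w.injective e]
  have hdown : ∀ {x z : Fin m}, w x ≤ x → w.SameCycle x z → w x ≤ z ∧ z ≤ x := by
    intro x z hx h
    have hmaps : ∀ u ∈ Finset.Icc (w x) x, w u ∈ Finset.Icc (w x) x := fun u hu => by
      rw [Finset.mem_Icc] at hu ⊢
      exact hw.down x u hu.1 hu.2
    have := sameCycle_of_eqOn (w := w) (v := w) (s := Finset.Icc (w x) x) (fun u => ?_)
      (fun _ _ => rfl) (by simpa using hx) h
    · simpa using this.1
    · refine ⟨fun hu => ?_, hmaps u⟩
      obtain ⟨v, hv, e⟩ := Finset.surjOn_of_injOn_of_card_le w hmaps w.injective.injOn le_rfl hu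
      rwa [← w.injective e]
  have hnext : ∀ x, IsNext (π.part x) x (w x) := by
    intro x
    refine ⟨hpart.2 ⟨1, by simp⟩, ?_⟩
    rcases lt_or_ge x (w x) with h | h
    · refine Or.inl ⟨h, fun z hz => ?_⟩
      by_contra hc
      have := hup (x := x) (y := z) (z := x) (by omega) (by omega) (hpart.1 hz).symm
      omega
    · exact Or.inr fun z hz => hdown h (hpart.1 hz)
  refine ⟨π, ?_, ?_⟩
  · intro B hB C hC hBC a ha b hb c hc d hd ⟨hab, hbc, hcd⟩
    have hB' : ∀ {x}, x ∈ B → π.part x = B := fun hx => π.part_eq_of_mem hB hx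
    have hbB : b ∉ B := fun h => hBC (π.eq_of_mem_parts hB hC h hb)
    -- With x the last element of B before b, the arc from x to w x passes over b, hence over the
    -- whole cycle C. So it passes over d and over c, although c lies in the cycle of x.
    obtain ⟨x, hx, hmax⟩ := (B.filter (· < b)).exists_max_image id ⟨a, by simp [ha, hab]⟩
    rw [Finset.mem_filter] at hx
    have hn := hnext x
    rw [hB' hx.1] at hn
    have hxwx : b < w x := by
      obtain ⟨hwx, ⟨h1, h2⟩ | h2⟩ := hn
      · by_contra hcon
        have hne : w x ≠ b := fun e => hbB (e ▸ hwx)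
        have := hmax (w x) (by simp only [Finset.mem_filter]; exact ⟨hwx, by omega⟩)
        simp only [id] at this
        omega
      · have := h2 c hc
        omega
    have hbd : w.SameCycle b d := by
      rw [← hpart, π.part_eq_of_mem hC hb]
      exact hd
    have := hup hx.2 hxwx hbd
    have h3 := hup (x := x) (y := c) (z := x) (by omega) (by omega) (by
      rw [← hpart, hB' hc]
      exact hx.1)
    omega
  · ext1 x
    exact (π.isNext_toPerm x).unique (hnext x)

theorem rho_toPerm (π : SetPartition m) (x : Fin m) :
    rho π.toPerm x = if ∀ y ∈ π.part x, x ≤ y then (π.part x).card - 1 else 0 := by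
  have : {y | π.toPerm.SameCycle x y} = (π.part x : Set (Fin m)) := by
    ext y
    exact π.sameCycle_toPerm
  simp only [rho, sameCycle_toPerm]
  congr 1
  rw [← Set.ncard_coe_finset]
  rfl

theorem filter_map_filter {β : Type*} (l : List β) (p : β → Bool) (f : β → ℕ) :
    (((l.filter p).map f).map fun k => k - 1).filter (fun k => decide (k ≠ 0)) =
      (l.map fun x => if p x = true then f x - 1 else 0).filter fun k => decide (k ≠ 0) := by
  induction l with
  | nil => rfl
  | cons x l ih =>
    by_cases h : p x = true
    · simp only [List.filter_cons_of_pos h, List.map_cons, h, if_true, List.filter_cons, ih]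
    · rw [List.filter_cons_of_neg h, ih, List.map_cons, if_neg h]
      simp

/-- Scanning the points in order visits the blocks by increasing minima; non-minima and singletons
give the value 0 and are filtered out. -/
theorem reducedOrderedType_eq (π : SetPartition m) :
    π.reducedOrderedType =
      ((List.finRange m).map (rho π.toPerm)).filter fun k => decide (k ≠ 0) := by
  rw [reducedOrderedType, orderedType, filter_map_filter]
  congr 1
  refine List.map_congr_left fun x _ => ?_
  simp only [rho_toPerm, decide_eq_true_eq]

/-! ### Extension to permutations of the natural numbers -/

/-- Extend a permutation of `{0, …, m - 1}` to all natural numbers. -/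
def ext (w : Perm (Fin m)) : Perm ℕ := w.extendDomain Fin.equivSubtype

theorem ext_apply (w : Perm (Fin m)) (x : Fin m) : ext w x = w x :=
  w.extendDomain_apply_image Fin.equivSubtype x

theorem ext_apply_of_le (w : Perm (Fin m)) {x : ℕ} (hx : m ≤ x) : ext w x = x :=
  w.extendDomain_apply_not_subtype Fin.equivSubtype (by omega)

theorem ext_supp {n : ℕ} (w : Perm (Fin (n + 1))) : SuppIn (ext w) 0 n := fun x hx =>
  ext_apply_of_le w (by omega)

theorem ext_injective : Function.Injective (ext (m := m)) := fun w v h => by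
  ext1 x
  apply Fin.ext
  rw [← ext_apply, h, ext_apply]

theorem sameCycle_ext (w : Perm (Fin m)) (x y : Fin m) :
    (ext w).SameCycle x y ↔ w.SameCycle x y :=
  Perm.sameCycle_extendDomain (f := Fin.equivSubtype)

theorem sameCycle_ext_lt (w : Perm (Fin m)) (x : Fin m) {y : ℕ} (h : (ext w).SameCycle x y) :
    y < m := by
  obtain ⟨n, rfl⟩ : ∃ n, m = n + 1 := ⟨m - 1, by have := x.isLt; omega⟩
  have := (ext_supp w).sameCycle (x := x) (by omega) (by omega) h
  omega

theorem rho_ext (w : Perm (Fin m)) (x : Fin m) : rho (ext w) x = rho w x := by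
  have hset : {y | (ext w).SameCycle x y} = Fin.val '' {y | w.SameCycle x y} := by
    ext y
    simp only [Set.mem_ofPred_eq, Set.mem_image]
    constructor
    · intro h
      exact ⟨⟨y, sameCycle_ext_lt w x h⟩, (sameCycle_ext w x ⟨y, sameCycle_ext_lt w x h⟩).1 h, rfl⟩
    · rintro ⟨y, h, rfl⟩
      exact (sameCycle_ext w x y).2 h
  have hmin : (∀ y, (ext w).SameCycle x y → (x : ℕ) ≤ y) ↔ ∀ y, w.SameCycle x y → x ≤ y := by
    constructor
    · intro h y hy
      exact h y ((sameCycle_ext w x y).2 hy)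
    · intro h y hy
      exact Fin.le_def.1 <| h ⟨y, sameCycle_ext_lt w x hy⟩
        ((sameCycle_ext w x ⟨y, sameCycle_ext_lt w x hy⟩).1 hy)
  rw [rho, rho, hset, Set.ncard_image_of_injective _ Fin.val_injective]
  by_cases h : ∀ y, w.SameCycle x y → x ≤ y
  · rw [if_pos h, if_pos (hmin.2 h)]
  · rw [if_neg h, if_neg fun h' => h (hmin.1 h')]

theorem map_rho_ext (w : Perm (Fin m)) :
    (List.finRange m).map (rho w) = (List.range' 0 m).map (rho (ext w)) := by
  apply List.ext_getElem
  · simp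
  · intro i h1 h2
    simp only [List.length_map, List.length_finRange] at h1
    simp [← rho_ext]

theorem isNCOn_ext {n : ℕ} {w : Perm (Fin (n + 1))} (hw : IsNC w) : IsNCOn (ext w) 0 n := by
  refine ⟨⟨fun x y h h' => ?_, fun x y h h' => ?_⟩, ext_supp w⟩
  · by_cases hx : x < n + 1
    · have ex : ext w x = w ⟨x, hx⟩ := ext_apply w ⟨x, hx⟩
      have hlt := (w ⟨x, hx⟩).2
      have hy : y < n + 1 := by omega
      have ey : ext w y = w ⟨y, hy⟩ := ext_apply w ⟨y, hy⟩
      have := hw.up ⟨x, hx⟩ ⟨y, hy⟩ h (by rw [Fin.lt_def]; dsimp only; omega)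
      simp only [Fin.lt_def] at this
      omega
    · rw [ext_apply_of_le w (by omega)] at h'
      omega
  · by_cases hx : x < n + 1
    · have ex : ext w x = w ⟨x, hx⟩ := ext_apply w ⟨x, hx⟩
      have hy : y < n + 1 := by omega
      have ey : ext w y = w ⟨y, hy⟩ := ext_apply w ⟨y, hy⟩
      have := hw.down ⟨x, hx⟩ ⟨y, hy⟩ (by rw [Fin.le_def]; dsimp only; omega) h'
      simp only [Fin.le_def] at this
      omega
    · rw [ext_apply_of_le w (by omega)] at h ⊢
      obtain rfl : y = x := by omega
      rw [ext_apply_of_le w (by omega)]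
      omega

theorem exists_ext_eq {n : ℕ} {w : Perm ℕ} (hw : IsNCOn w 0 n) :
    ∃ v : Perm (Fin (n + 1)), IsNC v ∧ ext v = w := by
  let v : Perm (Fin (n + 1)) :=
    { toFun := fun x => ⟨w x, by
        have := hw.supp.bounds (x := x) (by omega) (by omega)
        omega⟩
      invFun := fun x => ⟨w⁻¹ x, by
        have := hw.supp.inv.bounds (x := x) (by omega) (by omega)
        omega⟩
      left_inv := fun x => Fin.ext (inv_apply_apply w x)
      right_inv := fun x => Fin.ext (apply_inv_apply w x) }
  refine ⟨v, ⟨fun x y h h' => hw.up x y h h', fun x y h h' => hw.down x y h h'⟩, ?_⟩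
  ext x
  by_cases hx : x < n + 1
  · exact ext_apply v ⟨x, hx⟩
  · rw [ext_apply_of_le v (by omega), hw.supp x (by omega)]

theorem ext_finRotate (n : ℕ) : ext (finRotate (n + 1)) = longCycle 0 n := by
  ext x
  by_cases hx : x < n + 1
  · have := ext_apply (finRotate (n + 1)) ⟨x, hx⟩
    rw [coe_finRotate] at this
    dsimp only at this
    rw [this, longCycle_apply]
    simp only [Fin.ext_iff, Fin.val_last]
    split_ifs <;> omega
  · rw [ext_apply_of_le _ (by omega), longCycle_supp 0 n x (by omega)]

theorem ext_inv_mul_finRotate {n : ℕ} (w : Perm (Fin (n + 1))) :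
    ext (w⁻¹ * finRotate (n + 1)) = kreweras (ext w) 0 n := by
  rw [kreweras, ← ext_finRotate]
  simp only [ext, Perm.extendDomain_mul, Perm.extendDomain_inv]

theorem IsNoncrossing.exists_kreweras {n : ℕ} {π : SetPartition (n + 1)} (h : π.IsNoncrossing) :
    ∃ π', π.IsRightKrewerasComplement π' := by
  obtain ⟨v, hv, hv'⟩ := exists_ext_eq (isNCOn_ext h.isNC).kreweras
  obtain ⟨π', h', rfl⟩ := hv.exists_setPartition
  refine ⟨π', h', ext_injective ?_⟩
  rw [hv', ext_inv_mul_finRotate]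

end SetPartition

/-! ### Noncrossing partitions and binary trees -/

namespace NCPerm

open Equiv SetPartition BinaryTree

theorem swap_mul_apply_of_supp {w : Perm ℕ} {n : ℕ} (hw : SuppIn w 0 n) (x : ℕ) :
    (swap 0 (n + 1) * w) x = if x = n + 1 then 0 else if w x = 0 then n + 1 else w x := by
  rw [Perm.mul_apply]
  split_ifs with h h'
  · rw [h, hw _ (by omega), swap_apply_right]
  · rw [h', swap_apply_left]
  · refine swap_apply_of_ne_of_ne h' fun e => h ?_
    rw [← hw (n + 1) (by omega)] at e
    exact w.injective e

/-- The new point is placed at the end of the cycle of 0. The same transposition undoes this in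
`cutLast`, so noncrossing permutations of [0, n] correspond to those of [0, n + 1] sending n + 1 to
0. -/
theorem IsNCOn.addLast {w : Perm ℕ} {n : ℕ} (hw : IsNCOn w 0 n) :
    IsNCOn (swap 0 (n + 1) * w) 0 (n + 1) := by
  have happ := swap_mul_apply_of_supp hw.supp
  have hs : SuppIn (swap 0 (n + 1) * w) 0 (n + 1) :=
    (SuppIn.swap (by omega) (by omega)).mul (hw.supp.mono (by omega) (by omega))
  have hle : ∀ y, y ≤ n → w y ≤ n := fun y hy => by
    have := hw.supp.bounds (x := y) (by omega) (by omega)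
    omega
  refine ⟨⟨fun x y h h' => ?_, fun x y h h' => ?_⟩, hs⟩
  · rw [happ] at h' ⊢
    rw [happ]
    by_cases hxn : x = n + 1
    · rw [if_pos hxn] at h'
      omega
    rw [if_neg hxn] at h' ⊢
    by_cases hx : w x = 0
    · rw [if_pos hx] at h' ⊢
      -- As w x = 0, the interval [0, x] is stable, so a point beyond x stays beyond x.
      have hy : x < w y := by
        by_contra hc
        have := inv_mem_of_maps (w := w) (a := 0) (b := x) (fun u h1 h2 => by
          have := hw.down x u (by omega) h2
          omega) (x := w y) (by omega) (by omega)
        rw [inv_apply_apply] at this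
        omega
      have := hle y (by omega)
      rw [if_neg (by omega), if_neg (by omega)]
      omega
    · rw [if_neg hx] at h' ⊢
      have := hw.up x y h h'
      have hyn : y ≠ n + 1 := by
        rintro rfl
        by_cases hxn' : x ≤ n
        · have := hle x hxn'
          omega
        · omega
      rw [if_neg hyn, if_neg (by omega)]
      exact this
  · by_cases hxn : x = n + 1
    · have e : (swap 0 (n + 1) * w) x = 0 := by rw [happ, if_pos hxn]
      have := hs.bounds (x := y) (by omega) (by omega)
      omega
    · by_cases hxn' : x ≤ n
      · rw [happ x, if_neg hxn] at h ⊢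
        by_cases hx : w x = 0
        · rw [if_pos hx] at h
          omega
        · rw [if_neg hx] at h ⊢
          have := hw.down x y h h'
          rw [happ, if_neg (by omega), if_neg (by omega)]
          exact this
      · have := hs x (by omega)
        rw [this] at h ⊢
        obtain rfl : y = x := by omega
        omega

theorem IsNCOn.cutLast {w : Perm ℕ} {n : ℕ} (hw : IsNCOn w 0 (n + 1)) (h0 : w (n + 1) = 0) :
    IsNCOn (swap 0 (n + 1) * w) 0 n := by
  have happ : ∀ x, (swap 0 (n + 1) * w) x =
      if x = n + 1 then n + 1 else if w x = n + 1 then 0 else w x := by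
    intro x
    rw [Perm.mul_apply]
    split_ifs with h h'
    · rw [h, h0, swap_apply_left]
    · rw [h', swap_apply_right]
    · exact swap_apply_of_ne_of_ne (fun e => h (w.injective (e.trans h0.symm))) h'
  refine ⟨⟨fun x y h h' => ?_, fun x y h h' => ?_⟩, fun x hx => ?_⟩
  · rw [happ x] at h' ⊢
    by_cases hxn : x = n + 1
    · rw [if_pos hxn] at h'
      omega
    rw [if_neg hxn] at h' ⊢
    by_cases hx : w x = n + 1
    · rw [if_pos hx] at h'
      omega
    rw [if_neg hx] at h' ⊢
    have := hw.up x y h h'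
    have hb : w x ≤ n ∨ n + 1 < x := by
      have h1 := hw.supp.bounds (x := x) (by omega)
      omega
    rcases hb with hb | hb
    · rw [happ, if_neg (by omega), if_neg (by omega)]
      exact this
    · rw [hw.supp x (by omega)] at h'
      omega
  · by_cases hxn : x = n + 1
    · rw [happ, if_pos hxn] at h ⊢
      obtain rfl : y = n + 1 := by omega
      rw [happ, if_pos rfl]
      omega
    rw [happ x, if_neg hxn] at h ⊢
    by_cases hx : w x = n + 1
    · rw [if_pos hx]
      have hxn' : x ≤ n := by
        by_contra hc
        rw [hw.supp x (by omega)] at hx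
        omega
      rw [happ, if_neg (by omega)]
      split_ifs with hy
      · omega
      · have hyx : y ≠ x := fun e => hy (e ▸ hx)
        have hb := hw.supp.bounds (x := y) (by omega) (by omega)
        refine ⟨by omega, ?_⟩
        by_contra hc
        -- As w x = n + 1, the interval [x + 1, n] is stable, so a value in it cannot come from y ≤
        -- x.
        have := inv_mem_of_maps (w := w) (a := x + 1) (b := n) (fun u h1 h2 => by
          have := hw.up x u (by omega) (by omega)
          omega) (x := w y) (by omega) (by omega)
        rw [inv_apply_apply] at this
        omega
    · rw [if_neg hx] at h ⊢
      by_cases hxn' : x ≤ n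
      · have := hw.down x y h h'
        rw [happ, if_neg (by omega), if_neg (by omega)]
        exact this
      · rw [hw.supp x (by omega)] at h ⊢
        obtain rfl : y = x := by omega
        rw [happ, if_neg hxn, if_neg hx, hw.supp y (by omega)]
        omega
  · rw [happ]
    split_ifs with h h'
    · exact h.symm
    · rw [hw.supp x (by omega)] at h'
      omega
    · exact hw.supp x (by omega)

-- The bijection behind the sum: `permA` encodes a tree as a permutation of [0, n + 1], and the
-- point n + 1 is then cut off.
open Classical in
theorem sum_isNoncrossing {E : Type*} [AddCommMonoid E] (n : ℕ) (f : Perm ℕ → E) :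
    ∑ π : SetPartition (n + 1) with π.IsNoncrossing, f (ext π.toPerm) =
      ∑ t ∈ treesOfNumNodesEq (n + 1), f (swap 0 (n + 1) * permA t 0) := by
  symm
  have hex : ∀ t ∈ treesOfNumNodesEq (n + 1), ∃ π : SetPartition (n + 1),
      π.IsNoncrossing ∧ ext π.toPerm = swap 0 (n + 1) * permA t 0 := by
    intro t ht
    rw [mem_treesOfNumNodesEq] at ht
    have h := permA_isNCOn t 0
    have hl := permA_last t 0
    rw [ht] at h hl
    rw [zero_add] at hl
    obtain ⟨v, hv, hv'⟩ := exists_ext_eq (h.cutLast hl)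
    obtain ⟨π, hπ, rfl⟩ := hv.exists_setPartition
    exact ⟨π, hπ, hv'⟩
  choose F hF using hex
  have hinj : ∀ π π' : SetPartition (n + 1), π.toPerm = π'.toPerm → π = π' := by
    intro π π' h
    have hpart : ∀ x, π.part x = π'.part x := fun x => by
      ext y
      rw [← sameCycle_toPerm, h, sameCycle_toPerm]
    ext B
    constructor
    · intro hB
      obtain ⟨x, hx⟩ := π.nonempty_of_mem_parts hB
      rw [← π.part_eq_of_mem hB hx, hpart]
      simp
    · intro hB
      obtain ⟨x, hx⟩ := π'.nonempty_of_mem_parts hB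
      rw [← π'.part_eq_of_mem hB hx, ← hpart]
      simp
  refine Finset.sum_bij F (fun t ht => by simpa using (hF t ht).1) (fun t ht t' ht' e => ?_)
    (fun π hπ => ?_) (fun t ht => by rw [(hF t ht).2])
  · have h := (hF t ht).2
    rw [e, (hF t' ht').2] at h
    rw [mem_treesOfNumNodesEq] at ht ht'
    exact ((perm_injective t t' 0 (ht.trans ht'.symm)).1 (mul_left_cancel h).symm)
  · rw [Finset.mem_filter] at hπ
    have h := isNCOn_ext hπ.2.isNC
    obtain ⟨t, ht, e⟩ := (exists_tree (n + 1) 0 _ h.addLast).1 (by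
      rw [swap_mul_apply_of_supp h.supp, if_pos (by omega)])
    refine ⟨t, mem_treesOfNumNodesEq.2 ht, hinj _ _ (ext_injective ?_)⟩
    rw [(hF t _).2, e, swap_mul_self_mul]

section Word

variable {E : Type*} [Monoid E] {X : ℕ → E}

/-- Cutting the last point lowers the root cycle from `heightA r + 1` to `heightA r`; the point
itself contributed 1, being the maximum of that cycle. -/
theorem word_cutLast (hX : X 0 = 1) (u : Unit) (l r : BinaryTree Unit) :
    word X (swap 0 ((node u l r).numNodes) * permA (.node u l r) 0) 0 (node u l r).numNodes =
      X (heightA r) * (xB X l * xA X r) := by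
  set t := node u l r
  obtain ⟨n, hn⟩ : ∃ n, t.numNodes = n + 1 := ⟨_, rfl⟩
  have hA := permA_isNCOn t 0
  have hl := permA_last t 0
  rw [hn] at hA hl
  rw [zero_add] at hl
  have hw := hA.cutLast hl
  have hr := rho_permA t 0
  have hword := (word_perm hX t 0).1
  rw [hn] at hword ⊢
  set w := swap 0 (n + 1) * permA t 0 with hwdef
  have e : permA t 0 = swap (n + 1) 0 * w := by rw [hwdef, swap_comm, swap_mul_self_mul]
  have hq : w (n + 1) = n + 1 := hw.supp _ (by omega)
  have h0 := rho_insert_min hq (by omega) hw.supp.min_first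
    (hw.supp.finite le_rfl (by omega))
  rw [min_eq_right (by omega), ← e, hr] at h0
  have h1 := rho_insert_max hq (z := 0) (by omega)
  rw [max_eq_left (by omega), ← e] at h1
  have hh : heightA t = heightA r + 1 := rfl
  have hx : xA X t = xB X l * xA X r := by rw [xA]
  rw [word_add, word_one, show 0 + 1 + n = n + 1 by omega, h1, hX, mul_one] at hword
  rw [word_succ, ← hx, ← hword, show rho w 0 = heightA r by omega]
  congr 1
  exact word_congr X fun x h2 h3 => by
    rw [e, rho_insert_of_ne hq (by omega) hw.supp.min_first (by omega) (by omega)]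

/-- This is `kreweras_swap_mul` with a one-point right interval: the appended point is fixed by the
complement. -/
theorem kreweras_addLast (w : Perm ℕ) (n : ℕ) (hw : SuppIn w 0 n) :
    kreweras (swap 0 (n + 1) * w) 0 (n + 1) = kreweras w 0 n := by
  have h := kreweras_swap_mul (w₁ := w) (w₂ := 1) (a := 0) (m := n) (n := 0) hw fun _ _ => rfl
  have h1 : SuppIn 1 (0 + n + 1) 0 := fun _ _ => rfl
  rw [h1.kreweras.eq_one, mul_one, mul_one] at h
  simpa using h

theorem word_kreweras_cutLast (hX : X 0 = 1) (t : BinaryTree Unit) {n : ℕ}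
    (hn : t.numNodes = n + 1) :
    word X (kreweras (swap 0 (n + 1) * permA t 0) 0 n) 0 (n + 1) = yA X t := by
  have hA := permA_isNCOn t 0
  have hl := permA_last t 0
  have hk := krewerasA_last t 0
  have hword := (word_kreweras hX t 0).1
  rw [hn] at hA hl hk hword
  rw [zero_add] at hl hk
  rw [← kreweras_addLast _ _ (hA.cutLast hl).supp, swap_mul_self_mul, ← hword, word_add X _ 0 (n + 1) 1,
    word_one, zero_add, rho_of_fixed hk, hX, mul_one]

end Word

theorem sum_treesOfNumNodesEq_succ {E : Type*} [AddCommMonoid E] (n : ℕ)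
    (F : BinaryTree Unit → E) :
    ∑ t ∈ treesOfNumNodesEq (n + 1), F t = ∑ p ∈ Finset.HasAntidiagonal.antidiagonal n,
      ∑ l ∈ treesOfNumNodesEq p.1, ∑ r ∈ treesOfNumNodesEq p.2, F (node () l r) := by
  rw [treesOfNumNodesEq_succ, Finset.sum_biUnion]
  · refine Finset.sum_congr rfl fun p _ => ?_
    rw [pairwiseNode, Finset.sum_map, Finset.sum_product]
    rfl
  · intro p _ q _ hpq
    rw [Function.onFun, Finset.disjoint_left]
    intro t ht ht'
    simp only [pairwiseNode, Finset.mem_map, Finset.mem_product, mem_treesOfNumNodesEq] at ht ht'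
    obtain ⟨⟨l, r⟩, h, rfl⟩ := ht
    obtain ⟨⟨l', r'⟩, h', e⟩ := ht'
    have : l' = l ∧ r' = r := by simpa using e
    obtain ⟨rfl, rfl⟩ := this
    exact hpq (Prod.ext (h.1.symm.trans h'.1) (h.2.symm.trans h'.2))

open Classical in
theorem sum_word {E : Type*} [Semiring E] {X Y : ℕ → E} (hX : X 0 = 1) (hY : Y 0 = 1) (n : ℕ) :
    (∑ π : SetPartition (n + 1) with π.IsNoncrossing,
        word X (ext π.toPerm) 0 (n + 1) * word Y (kreweras (ext π.toPerm) 0 n) 0 (n + 1)) =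
      ∑ p ∈ Finset.HasAntidiagonal.antidiagonal n,
        ∑ l ∈ treesOfNumNodesEq p.1, ∑ r ∈ treesOfNumNodesEq p.2,
          X (heightA r) * (xB X l * xA X r) * (Y (heightB l) * yB Y l * yA Y r) := by
  rw [sum_isNoncrossing n fun w => word X w 0 (n + 1) * word Y (kreweras w 0 n) 0 (n + 1),
    sum_treesOfNumNodesEq_succ]
  refine Finset.sum_congr rfl fun p hp => Finset.sum_congr rfl fun l hl =>
    Finset.sum_congr rfl fun r hr => ?_
  rw [mem_treesOfNumNodesEq] at hl hr
  have hp := Finset.HasAntidiagonal.mem_antidiagonal.1 hp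
  have h : (node () l r).numNodes = n + 1 := by rw [numNodes, hl, hr, hp]
  have := word_cutLast hX () l r
  rw [h] at this
  rw [this, word_kreweras_cutLast hY _ h, yA]

end NCPerm

/-! ## Substitution in power series with noncommuting coefficients -/

namespace LeftComp

open PowerSeries Finset
open Finset.HasAntidiagonal (antidiagonal)

theorem sum_antidiagonal_assoc {M : Type*} [AddCommMonoid M] (n : ℕ) (F : ℕ → ℕ → ℕ → M) :
    ∑ p ∈ antidiagonal n, ∑ q ∈ antidiagonal p.1, F q.1 q.2 p.2 =
      ∑ p ∈ antidiagonal n, ∑ q ∈ antidiagonal p.2, F p.1 q.1 q.2 := by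
  rw [Finset.sum_sigma', Finset.sum_sigma']
  refine Finset.sum_nbij' (fun x => ⟨(x.2.1, x.2.2 + x.1.2), (x.2.2, x.1.2)⟩)
    (fun x => ⟨(x.1.1 + x.2.1, x.2.2), (x.1.1, x.2.1)⟩) ?_ ?_ ?_ ?_ ?_
  · rintro ⟨⟨a, b⟩, ⟨c, d⟩⟩ h
    simp at h ⊢
    omega
  · rintro ⟨⟨a, b⟩, ⟨c, d⟩⟩ h
    simp at h ⊢
    omega
  · rintro ⟨⟨a, b⟩, ⟨c, d⟩⟩ h
    simp at h ⊢
    obtain ⟨h1, rfl⟩ := h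
    rfl
  · rintro ⟨⟨a, b⟩, ⟨c, d⟩⟩ h
    simp at h ⊢
    obtain ⟨h1, rfl⟩ := h
    rfl
  · rintro ⟨⟨a, b⟩, ⟨c, d⟩⟩ h
    rfl

theorem sum_antidiagonal_left_comm {M : Type*} [AddCommMonoid M] (n : ℕ) (F : ℕ → ℕ → ℕ → M) :
    ∑ p ∈ antidiagonal n, ∑ q ∈ antidiagonal p.2, F p.1 q.1 q.2 =
      ∑ p ∈ antidiagonal n, ∑ q ∈ antidiagonal p.2, F q.1 p.1 q.2 := by
  rw [← sum_antidiagonal_assoc, ← sum_antidiagonal_assoc n fun a b c => F b a c]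
  refine Finset.sum_congr rfl fun p _ => ?_
  exact Finset.sum_nbij' Prod.swap Prod.swap (fun q hq => by
    rw [HasAntidiagonal.mem_antidiagonal] at hq ⊢
    exact (add_comm _ _).trans hq) (fun q hq => by
    rw [HasAntidiagonal.mem_antidiagonal] at hq ⊢
    exact (add_comm _ _).trans hq) (fun _ _ => rfl) (fun _ _ => rfl) (fun _ _ => rfl)

variable {E : Type*} [Semiring E]

/-- The power series `∑ k, f k * t ^ k * V k`. -/
def leftComp (f : ℕ → E) (V : ℕ → E⟦X⟧) : E⟦X⟧ :=
  PowerSeries.mk fun n => ∑ p ∈ antidiagonal n, f p.1 * coeff p.2 (V p.1)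

theorem coeff_leftComp (f : ℕ → E) (V : ℕ → E⟦X⟧) (n : ℕ) :
    coeff n (leftComp f V) = ∑ p ∈ antidiagonal n, f p.1 * coeff p.2 (V p.1) := by
  rw [leftComp, coeff_mk]

/-- Coefficients stand on the left and t is central, so a right factor enters the sum with no
commutation hypothesis. -/
theorem leftComp_mul (f : ℕ → E) (V : ℕ → E⟦X⟧) (u : E⟦X⟧) :
    leftComp f V * u = leftComp f fun k => V k * u := by
  ext n
  simp only [coeff_mul, coeff_leftComp, Finset.sum_mul, Finset.mul_sum]
  rw [sum_antidiagonal_assoc n fun a b c => f a * coeff b (V a) * coeff c u]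
  simp only [mul_assoc]

theorem leftComp_leftComp (f : ℕ → E) (h : ℕ → ℕ → E) (V : ℕ → E⟦X⟧) :
    leftComp f (fun k => leftComp (h k) fun j => V (k + j)) =
      leftComp (fun n => ∑ p ∈ antidiagonal n, f p.1 * h p.1 p.2) V := by
  ext n
  simp only [coeff_leftComp, Finset.sum_mul, Finset.mul_sum]
  rw [← sum_antidiagonal_assoc n fun a b c => f a * (h a b * coeff c (V (a + b)))]
  refine Finset.sum_congr rfl fun p _ => Finset.sum_congr rfl fun q hq => ?_
  rw [HasAntidiagonal.mem_antidiagonal.1 hq, mul_assoc]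

theorem leftComp_comm {f g : ℕ → E} (hfg : ∀ i j, Commute (f i) (g j)) (V : ℕ → ℕ → E⟦X⟧) :
    leftComp f (fun i => leftComp g fun j => V i j) =
      leftComp g fun j => leftComp f fun i => V i j := by
  ext n
  simp only [coeff_leftComp, Finset.mul_sum]
  rw [sum_antidiagonal_left_comm n fun a b c => f a * (g b * coeff c (V a b))]
  refine Finset.sum_congr rfl fun p _ => Finset.sum_congr rfl fun q _ => ?_
  rw [← mul_assoc, (hfg _ _).eq, mul_assoc]

theorem map_leftComp {E' : Type*} [Semiring E'] (φ : E →+* E') (f : ℕ → E) (V : ℕ → E⟦X⟧) :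
    PowerSeries.map φ (leftComp f V) = leftComp (fun k => φ (f k)) fun k =>
      PowerSeries.map φ (V k) := by
  ext n
  simp only [coeff_leftComp, coeff_map, map_sum, map_mul]

theorem leftComp_eq_of_coeff {f : ℕ → E} {V : ℕ → E⟦X⟧} {W : E⟦X⟧}
    (h : ∀ n, coeff n W = ∑ k ∈ range (n + 1), f k * coeff (n - k) (V k)) :
    W = leftComp f V := by
  ext n
  rw [h, coeff_leftComp, Finset.Nat.sum_antidiagonal_eq_sum_range_succ_mk]

/-- Power series agree in degrees below `n`. -/
def lowCon (E : Type*) [Semiring E] (n : ℕ) : RingCon E⟦X⟧ where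
  r a b := ∀ m < n, coeff m a = coeff m b
  iseqv := ⟨fun _ _ _ => rfl, fun h m hm => (h m hm).symm,
    fun h h' m hm => (h m hm).trans (h' m hm)⟩
  mul' {a b c d} h h' m hm := by
    rw [coeff_mul, coeff_mul]
    refine Finset.sum_congr rfl fun p hp => ?_
    have := HasAntidiagonal.mem_antidiagonal.1 hp
    rw [h p.1 (by omega), h' p.2 (by omega)]
  add' {a b c d} h h' m hm := by
    rw [map_add, map_add, h m hm, h' m hm]

/-- Truncation in degree n is a ring congruence, and in the quotient a and b commute, hence so do
their powers. -/
theorem coeff_pow_comm {a b : E⟦X⟧} {n : ℕ} (h : ∀ m < n, coeff m (a * b) = coeff m (b * a))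
    (i j : ℕ) : ∀ m < n, coeff m (a ^ i * b ^ j) = coeff m (b ^ j * a ^ i) := by
  let c := lowCon E n
  have hc : Commute (a : c.Quotient) (b : c.Quotient) := (c.eq (a := a * b)).2 h
  exact (c.eq (a := a ^ i * b ^ j) (b := b ^ j * a ^ i)).1 (hc.pow_pow i j)

-- Coupled systems of functional equations

section Coupled

variable {f g : ℕ → E} {A B : E⟦X⟧}

/-- The two solutions of a coupled system commute. -/
theorem coupled_comm (hfg : ∀ i j, Commute (f i) (g j)) (hA : A = leftComp f fun k => B ^ k)
    (hB : B = leftComp g fun k => A ^ k) : A * B = B * A := by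
  have hAB : A * B = leftComp f fun i => leftComp g fun j => A ^ j * B ^ i := by
    conv_lhs => rw [hA]
    rw [leftComp_mul]
    congr 1
    ext1 i
    rw [(Commute.refl B).pow_left i |>.eq]
    exact (congrArg (· * B ^ i) hB).trans (leftComp_mul _ _ _)
  have hBA : B * A = leftComp f fun i => leftComp g fun j => B ^ i * A ^ j := by
    rw [leftComp_comm hfg]
    conv_lhs => rw [hB]
    rw [leftComp_mul]
    congr 1
    ext1 i
    rw [(Commute.refl A).pow_left i |>.eq]
    exact (congrArg (· * A ^ i) hA).trans (leftComp_mul _ _ _)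
  ext n
  induction n using Nat.strong_induction_on with
  | _ n ih =>
    rw [hAB, hBA]
    simp only [coeff_leftComp]
    refine Finset.sum_congr rfl fun p hp => ?_
    congr 1
    refine Finset.sum_congr rfl fun q hq => ?_
    congr 1
    rw [HasAntidiagonal.mem_antidiagonal] at hp hq
    -- If both exponents vanish, both products are 1; otherwise the remaining degree is below n and
    -- the induction hypothesis applies.
    by_cases h0 : p.1 = 0 ∧ q.1 = 0
    · simp [h0.1, h0.2]
    · exact coeff_pow_comm ih q.1 p.1 q.2 (by omega)

/-- Left substitution F ↦ F(tB) is multiplicative here: since A commutes with B, the factor A can be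
moved past B^k before it is expanded, keeping all coefficients on the left. -/
theorem leftComp_coeff_pow {F : E⟦X⟧} (hA : A = leftComp (fun k => coeff k F) fun k => B ^ k)
    (hAB : A * B = B * A) (i : ℕ) : A ^ i = leftComp (fun k => coeff k (F ^ i)) fun k => B ^ k := by
  induction i with
  | zero =>
    ext n
    rw [coeff_leftComp, Finset.sum_eq_single (0, n)]
    · simp
    · intro p _ hp
      have : p.1 ≠ 0 := fun h => by
        rename_i hmem
        rw [HasAntidiagonal.mem_antidiagonal] at hmem
        exact hp (Prod.ext h (by simp only; omega))
      simp [coeff_one, this]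
    · simp [HasAntidiagonal.mem_antidiagonal]
  | succ i ih =>
    rw [pow_succ]
    conv_lhs => rw [ih]
    rw [leftComp_mul]
    have : ∀ k, B ^ k * A = leftComp (fun j => coeff j F) fun j => B ^ (k + j) := by
      intro k
      have hc : Commute A B := hAB
      rw [← (hc.pow_right k).eq]
      conv_lhs => rw [hA]
      rw [leftComp_mul]
      congr 1
      ext1 j
      rw [← pow_add, add_comm]
    simp only [this]
    rw [leftComp_leftComp (fun k => coeff k (F ^ i)) (fun _ j => coeff j F) fun k => B ^ k]
    congr 1
    ext1 n
    rw [pow_succ, coeff_mul]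

/-- Substitute tB into F = ∑ s_k t^k F^k: the k-th term becomes s_k t^k B^k F^k(tB), and B^k A^k =
(AB)^k. -/
theorem leftComp_lagrange {s : ℕ → E} {F : E⟦X⟧} (hF : F = leftComp s fun k => F ^ k)
    (hA : A = leftComp (fun k => coeff k F) fun k => B ^ k) (hAB : A * B = B * A) :
    A = leftComp s fun k => (A * B) ^ k := by
  have hc : Commute A B := hAB
  have hpow : ∀ k, (A * B) ^ k = leftComp (fun j => coeff j (F ^ k)) fun j => B ^ (k + j) := by
    intro k
    rw [hc.mul_pow, leftComp_coeff_pow hA hAB k, leftComp_mul]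
    congr 1
    ext1 j
    rw [← pow_add, add_comm]
  simp only [hpow]
  rw [leftComp_leftComp s (fun k j => coeff j (F ^ k)) fun k => B ^ k]
  conv_lhs => rw [hA]
  congr 1
  ext1 n
  conv_lhs => rw [hF]
  rw [coeff_leftComp]

/-- The product of the two solutions of a coupled system is the Lagrange series of the product
alphabet. -/
theorem coupled_mul {s s' : ℕ → E} {F G : E⟦X⟧} (hFG : ∀ i j, Commute (coeff i F) (coeff j G))
    (hF : F = leftComp s fun k => F ^ k) (hG : G = leftComp s' fun k => G ^ k)
    (hA : A = leftComp (fun k => coeff k F) fun k => B ^ k)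
    (hB : B = leftComp (fun k => coeff k G) fun k => A ^ k) :
    A * B = leftComp (fun n => ∑ p ∈ antidiagonal n, s p.1 * s' p.2) fun k => (A * B) ^ k := by
  have hAB := coupled_comm hFG hA hB
  have hc : Commute A B := hAB
  have hA' := leftComp_lagrange hF hA hAB
  have hB' := leftComp_lagrange hG hB hAB.symm
  -- AB = ∑ s_k t^k (AB)^k B = ∑ s_k t^k B (AB)^k. Expanding B in powers of BA = AB then produces
  -- the convolution of s and s'.
  rw [← leftComp_leftComp s (fun _ j => s' j) fun k => (A * B) ^ k]
  conv_lhs => rw [hA']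
  rw [leftComp_mul]
  congr 1
  ext1 k
  rw [((hc.symm.mul_right (Commute.refl B)).pow_right k).eq.symm]
  refine (congrArg (· * (A * B) ^ k) hB').trans ?_
  rw [leftComp_mul]
  congr 1
  ext1 j
  rw [← hAB, ← pow_add, add_comm]

end Coupled

end LeftComp

namespace NCPerm

open BinaryTree LeftComp
open PowerSeries (coeff)
open Finset.HasAntidiagonal (antidiagonal)

/-! ### Generating series of binary trees -/

section Series

variable {E : Type*} [Semiring E] (X Y : ℕ → E)

/-- The generating series of noncrossing permutations sending the last point to the first. -/
def seriesA : PowerSeries E :=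
  PowerSeries.mk fun n => ∑ t ∈ treesOfNumNodesEq n, X (heightA t) * (xA X t * yA Y t)

/-- The generating series of noncrossing permutations fixing the first point. -/
def seriesB : PowerSeries E :=
  PowerSeries.mk fun n => ∑ t ∈ treesOfNumNodesEq n, Y (heightB t) * (xB X t * yB Y t)

/-- The part of `seriesA` of root degree `h`, without the factor of the root. -/
def partA (h : ℕ) : PowerSeries E :=
  PowerSeries.mk fun n =>
    ∑ t ∈ treesOfNumNodesEq n, if heightA t = h then xA X t * yA Y t else 0

/-- The part of `seriesB` of root degree `h`, without the factor of the root. -/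
def partB (h : ℕ) : PowerSeries E :=
  PowerSeries.mk fun n =>
    ∑ t ∈ treesOfNumNodesEq n, if heightB t = h then xB X t * yB Y t else 0

theorem heightA_le (t : BinaryTree Unit) : heightA t ≤ t.numNodes := by
  induction t with
  | nil => exact le_rfl
  | node _ l r _ ih => rw [heightA, numNodes]; omega

theorem heightB_le (t : BinaryTree Unit) : heightB t ≤ t.numNodes := by
  induction t with
  | nil => exact le_rfl
  | node _ l r ih _ => rw [heightB, numNodes]; omega

variable {X Y}

theorem commute_x {z : E} (hz : ∀ i, Commute z (X i)) (t : BinaryTree Unit) :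
    Commute z (xA X t) ∧ Commute z (xB X t) := by
  induction t with
  | nil => rw [xA, xB]; exact ⟨.one_right _, .one_right _⟩
  | node _ l r ihl ihr =>
    rw [xA, xB]
    exact ⟨ihl.2.mul_right ihr.1, ihl.2.mul_right ((hz _).mul_right ihr.1)⟩

theorem commute_y {z : E} (hz : ∀ i, Commute z (Y i)) (t : BinaryTree Unit) :
    Commute z (yA Y t) ∧ Commute z (yB Y t) := by
  induction t with
  | nil => rw [yA, yB]; exact ⟨.one_right _, .one_right _⟩
  | node _ l r ihl ihr =>
    rw [yA, yB]
    exact ⟨((hz _).mul_right ihl.2).mul_right ihr.1, ihl.2.mul_right ihr.1⟩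

/-- Groups the trees by `heightA`; any N > k is enough, as the height is at most the number of
nodes. -/
theorem coeff_seriesA {N k : ℕ} (h : k < N) :
    coeff k (seriesA X Y) = ∑ i ∈ Finset.range N, X i * coeff k (partA X Y i) := by
  simp only [seriesA, partA, PowerSeries.coeff_mk, Finset.mul_sum]
  rw [Finset.sum_comm]
  refine Finset.sum_congr rfl fun t ht => ?_
  rw [mem_treesOfNumNodesEq] at ht
  have := heightA_le t
  rw [Finset.sum_eq_single (heightA t)]
  · rw [if_pos rfl]
  · intro i _ hi
    rw [if_neg hi.symm, mul_zero]
  · intro hi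
    rw [Finset.mem_range] at hi
    omega

theorem coeff_seriesB {N k : ℕ} (h : k < N) :
    coeff k (seriesB X Y) = ∑ i ∈ Finset.range N, Y i * coeff k (partB X Y i) := by
  simp only [seriesB, partB, PowerSeries.coeff_mk, Finset.mul_sum]
  rw [Finset.sum_comm]
  refine Finset.sum_congr rfl fun t ht => ?_
  rw [mem_treesOfNumNodesEq] at ht
  have := heightB_le t
  rw [Finset.sum_eq_single (heightB t)]
  · rw [if_pos rfl]
  · intro i _ hi
    rw [if_neg hi.symm, mul_zero]
  · intro hi
    rw [Finset.mem_range] at hi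
    omega

theorem partA_zero : partA X Y 0 = 1 := by
  ext n
  rw [partA, PowerSeries.coeff_mk, PowerSeries.coeff_one]
  rcases n with _ | n
  · simp [heightA, xA, yA]
  · rw [sum_treesOfNumNodesEq_succ]
    simp [heightA]

theorem partB_zero : partB X Y 0 = 1 := by
  ext n
  rw [partB, PowerSeries.coeff_mk, PowerSeries.coeff_one]
  rcases n with _ | n
  · simp [heightB, xB, yB]
  · rw [sum_treesOfNumNodesEq_succ]
    simp [heightB]

variable (hXY : ∀ i j, Commute (X i) (Y j))
include hXY

theorem commute_xA (t t' : BinaryTree Unit) (i : ℕ) :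
    Commute (xA X t) (Y i) ∧ Commute (xA X t) (yB Y t') ∧ Commute (xB X t) (Y i) := by
  have h : ∀ j, Commute (Y j) (xA X t) := fun j => (commute_x (fun i => (hXY i j).symm) t).1
  exact ⟨(h i).symm, (commute_y (fun j => (h j).symm) t').2,
    (commute_x (fun k => (hXY k i).symm) t).2.symm⟩

/-- Removing the root leaves an arbitrary left subtree, counted by B, and a right subtree of height
one less; the commutation of X with Y sorts the factors. -/
theorem partA_succ (h : ℕ) :
    partA X Y (h + 1) = PowerSeries.X * (seriesB X Y * partA X Y h) := by
  ext n
  rcases n with _ | n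
  · simp [partA, heightA]
  · rw [PowerSeries.coeff_succ_X_mul, PowerSeries.coeff_mul, partA, PowerSeries.coeff_mk,
      sum_treesOfNumNodesEq_succ]
    refine Finset.sum_congr rfl fun p _ => ?_
    rw [seriesB, partA, PowerSeries.coeff_mk, PowerSeries.coeff_mk, Finset.sum_mul_sum]
    refine Finset.sum_congr rfl fun l _ => Finset.sum_congr rfl fun r _ => ?_
    simp only [heightA, Nat.add_right_cancel_iff]
    split_ifs
    · obtain ⟨h1, h2, -⟩ := commute_xA hXY r l (heightB l)
      obtain ⟨-, -, h3⟩ := commute_xA hXY l l (heightB l)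
      rw [xA, yA]
      calc xB X l * xA X r * (Y (heightB l) * yB Y l * yA Y r)
          = xB X l * (xA X r * (Y (heightB l) * yB Y l)) * yA Y r := by simp only [mul_assoc]
        _ = xB X l * Y (heightB l) * yB Y l * (xA X r * yA Y r) := by
          rw [(h1.mul_right h2).eq]; simp only [mul_assoc]
        _ = _ := by rw [h3.eq]; simp only [mul_assoc]
    · rw [mul_zero]

theorem partB_succ (h : ℕ) :
    partB X Y (h + 1) = PowerSeries.X * (partB X Y h * seriesA X Y) := by
  ext n
  rcases n with _ | n
  · simp [partB, heightB]
  · rw [PowerSeries.coeff_succ_X_mul, PowerSeries.coeff_mul, partB, PowerSeries.coeff_mk,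
      sum_treesOfNumNodesEq_succ]
    refine Finset.sum_congr rfl fun p _ => ?_
    rw [seriesA, partB, PowerSeries.coeff_mk, PowerSeries.coeff_mk, Finset.sum_mul_sum]
    refine Finset.sum_congr rfl fun l _ => Finset.sum_congr rfl fun r _ => ?_
    simp only [heightB, Nat.add_right_cancel_iff]
    split_ifs
    · obtain ⟨-, h2, -⟩ := commute_xA hXY r l 0
      have h3 : Commute (X (heightA r)) (yB Y l) := (commute_y (hXY _) l).2
      rw [xB, yB]
      calc xB X l * (X (heightA r) * xA X r) * (yB Y l * yA Y r)
          = xB X l * ((X (heightA r) * xA X r) * yB Y l) * yA Y r := by simp only [mul_assoc]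
        _ = _ := by rw [(h3.mul_left h2).eq]; simp only [mul_assoc]
    · rw [zero_mul]

theorem partA_eq (h : ℕ) : partA X Y h = PowerSeries.X ^ h * seriesB X Y ^ h := by
  induction h with
  | zero => rw [partA_zero, pow_zero, pow_zero, mul_one]
  | succ h ih =>
    rw [partA_succ hXY, ih, pow_succ', pow_succ' (seriesB X Y), ← mul_assoc (seriesB X Y),
      (PowerSeries.commute_X_pow (seriesB X Y) h).eq]
    simp only [mul_assoc]

theorem partB_eq (h : ℕ) : partB X Y h = PowerSeries.X ^ h * seriesA X Y ^ h := by
  induction h with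
  | zero => rw [partB_zero, pow_zero, pow_zero, mul_one]
  | succ h ih =>
    rw [partB_succ hXY, ih, pow_succ', pow_succ (seriesA X Y)]
    simp only [mul_assoc]

theorem seriesA_eq : seriesA X Y = leftComp X fun k => seriesB X Y ^ k := by
  refine leftComp_eq_of_coeff fun n => ?_
  rw [coeff_seriesA (Nat.lt_succ_self n)]
  refine Finset.sum_congr rfl fun k hk => ?_
  rw [Finset.mem_range] at hk
  rw [partA_eq hXY, PowerSeries.coeff_X_pow_mul', if_pos (by omega)]

theorem seriesB_eq : seriesB X Y = leftComp Y fun k => seriesA X Y ^ k := by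
  refine leftComp_eq_of_coeff fun n => ?_
  rw [coeff_seriesB (Nat.lt_succ_self n)]
  refine Finset.sum_congr rfl fun k hk => ?_
  rw [Finset.mem_range] at hk
  rw [partB_eq hXY, PowerSeries.coeff_X_pow_mul', if_pos (by omega)]

open Classical SetPartition in
/-- The sum over all noncrossing partitions of the products over their blocks and over the blocks
of their Kreweras complements. -/
theorem sum_word_eq_coeff (hX : X 0 = 1) (hY : Y 0 = 1) (n : ℕ) :
    (∑ π : SetPartition (n + 1) with π.IsNoncrossing,
        word X (ext π.toPerm) 0 (n + 1) * word Y (kreweras (ext π.toPerm) 0 n) 0 (n + 1)) =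
      coeff n (seriesA X Y * seriesB X Y) := by
  -- In the word of a tree the factors of the left subtree follow X_i and precede those of the right
  -- one, while AB puts B last. The part of height i is t^i B^i, so the two orders agree.
  have hAB : ∀ i, partA X Y i * seriesB X Y = seriesB X Y * partA X Y i := fun i => by
    have h1 := (PowerSeries.commute_X_pow (seriesB X Y) i).symm
    have h2 := ((Commute.refl (seriesB X Y)).pow_left i)
    rw [partA_eq hXY]
    exact (h1.mul_left h2).eq
  have h1 : coeff n (seriesA X Y * seriesB X Y) =
      ∑ i ∈ Finset.range (n + 1), X i * coeff n (seriesB X Y * partA X Y i) := by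
    simp only [← hAB, PowerSeries.coeff_mul, Finset.mul_sum]
    rw [Finset.sum_comm]
    refine Finset.sum_congr rfl fun p hp => ?_
    have := Finset.HasAntidiagonal.mem_antidiagonal.1 hp
    rw [coeff_seriesA (N := n + 1) (by omega), Finset.sum_mul]
    simp only [mul_assoc]
  -- Read backwards, `partA_succ` turns this product into a sum over trees with n + 1 nodes whose
  -- right subtree has height i.
  have h2 : ∀ i, coeff n (seriesB X Y * partA X Y i) = coeff (n + 1) (partA X Y (i + 1)) :=
    fun i => by rw [partA_succ hXY, PowerSeries.coeff_succ_X_mul]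
  rw [h1, sum_word hX hY]
  simp only [h2]
  simp only [partA, PowerSeries.coeff_mk, sum_treesOfNumNodesEq_succ, Finset.mul_sum]
  symm
  rw [Finset.sum_comm]
  refine Finset.sum_congr rfl fun p hp => ?_
  rw [Finset.sum_comm]
  refine Finset.sum_congr rfl fun l hl => ?_
  rw [Finset.sum_comm]
  refine Finset.sum_congr rfl fun r hr => ?_
  have hp := Finset.HasAntidiagonal.mem_antidiagonal.1 hp
  rw [mem_treesOfNumNodesEq] at hr
  have hle := heightA_le r
  rw [Finset.sum_eq_single (heightA r)]
  · rw [if_pos (by rw [heightA]), xA, yA]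
    simp only [mul_assoc]
  · intro i _ hi
    rw [heightA, if_neg (by omega), mul_zero]
  · intro hi
    rw [Finset.mem_range] at hi
    omega

end Series

end NCPerm

/-! ## The Lagrange basis -/

namespace NSym

open LeftComp
open PowerSeries (coeff)
open Finset.HasAntidiagonal (antidiagonal)

/-- The explicit factor t^k makes the degree n coefficient depend on lower ones only, the term k = 0
being constant. -/
theorem _root_.LeftComp.leftComp_pow_unique {E : Type*} [Semiring E] {f : ℕ → E}
    {a b : PowerSeries E} (ha : a = leftComp f fun k => a ^ k)
    (hb : b = leftComp f fun k => b ^ k) : a = b := by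
  ext n
  induction n using Nat.strong_induction_on with
  | _ n ih =>
    rw [ha, hb, coeff_leftComp, coeff_leftComp]
    refine Finset.sum_congr rfl fun p hp => ?_
    have := Finset.HasAntidiagonal.mem_antidiagonal.1 hp
    rcases Nat.eq_zero_or_pos p.1 with h | h
    · rw [h, pow_zero, pow_zero]
    · rw [coeff_pow_congr ih p.1 p.2 (by omega)]

/-- Isolates f n, whose coefficient is 1; the equation can therefore be solved recursively for f as
well as for a. -/
theorem _root_.LeftComp.coeff_leftComp_pow {E : Type*} [Semiring E] (f : ℕ → E)
    {a : PowerSeries E} (ha : coeff 0 a = 1) (n : ℕ) :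
    coeff n (leftComp f fun k => a ^ k) =
      (∑ k : Fin n, f k * coeff (n - k) (a ^ (k : ℕ))) + f n := by
  have h0 : ∀ k, coeff 0 (a ^ k) = 1 := fun k => by
    rw [PowerSeries.coeff_zero_eq_constantCoeff_apply] at ha ⊢
    rw [map_pow, ha, one_pow]
  rw [coeff_leftComp, Finset.Nat.sum_antidiagonal_eq_sum_range_succ_mk, Finset.sum_range_succ,
    Nat.sub_self, h0, mul_one, Finset.sum_range fun k => f k * coeff (n - k) (a ^ k)]

variable (R : Type*) [CommRing R]

theorem lagrangeRHS_eq_leftComp (a : PowerSeries (NSym R)) :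
    lagrangeRHS R a = leftComp (S R) fun k => a ^ k :=
  leftComp_eq_of_coeff fun n => by rw [lagrangeRHS, PowerSeries.coeff_mk]

theorem lagrange_eq_leftComp : lagrange R = leftComp (S R) fun k => lagrange R ^ k :=
  (lagrange_eq R).trans (lagrangeRHS_eq_leftComp R _)

theorem coeff_lagrange (n : ℕ) : coeff n (lagrange R) = g R n := by
  rw [lagrange, PowerSeries.coeff_mk]

theorem g_zero : g R 0 = 1 := by
  rw [← coeff_lagrange, lagrange_eq_leftComp, coeff_leftComp]
  simp [S_zero]

/-- The generating series of the complete noncommutative symmetric functions. -/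
def complete : PowerSeries (NSym R) := PowerSeries.mk (S R)

/-- The elements expressing the generators through the Lagrange series. -/
def lagrangeInv (n : ℕ) : NSym R :=
  S R n - ∑ k : Fin n, lagrangeInv k * coeff (n - k) (complete R ^ (k : ℕ))
termination_by n
decreasing_by exact k.2

theorem complete_eq_leftComp :
    complete R = leftComp (lagrangeInv R) fun k => complete R ^ k := by
  ext n
  rw [coeff_leftComp_pow _ (by rw [complete, PowerSeries.coeff_mk, S_zero])]
  conv_rhs => rw [lagrangeInv]
  rw [add_sub_cancel, complete, PowerSeries.coeff_mk]

theorem lagrangeInv_zero : lagrangeInv R 0 = 1 := by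
  rw [lagrangeInv]
  simp [S_zero]

/-- The algebra endomorphism sending `S_n` to `g_n`. -/
def toLagrange : NSym R →ₐ[R] NSym R := FreeAlgebra.lift R fun n => g R n

/-- The inverse of `toLagrange`. -/
def ofLagrange : NSym R →ₐ[R] NSym R := FreeAlgebra.lift R fun n => lagrangeInv R n

theorem toLagrange_S (n : ℕ) : toLagrange R (S R n) = g R n := by
  rcases Nat.eq_zero_or_pos n with rfl | h
  · rw [S_zero, g_zero, map_one]
  · exact lift_S R _ ⟨n, h⟩

theorem ofLagrange_S (n : ℕ) : ofLagrange R (S R n) = lagrangeInv R n := by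
  rcases Nat.eq_zero_or_pos n with rfl | h
  · rw [S_zero, lagrangeInv_zero, map_one]
  · exact lift_S R _ ⟨n, h⟩

/-- Applied to the Lagrange equation, `ofLagrange` gives the equation that defines `lagrangeInv`
from the complete series; uniqueness of the series concludes. -/
theorem ofLagrange_g (n : ℕ) : ofLagrange R (g R n) = S R n := by
  have h : PowerSeries.map (ofLagrange R : NSym R →+* NSym R) (lagrange R) = complete R := by
    refine leftComp_pow_unique (f := lagrangeInv R) ?_ (complete_eq_leftComp R)
    conv_lhs => rw [lagrange_eq_leftComp, map_leftComp]
    simp [ofLagrange_S]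
  have := congrArg (coeff n) h
  rwa [PowerSeries.coeff_map, coeff_lagrange, complete, PowerSeries.coeff_mk] at this

/-- Here the series is fixed and two families of coefficients satisfy the same equation, so they
agree by triangularity. -/
theorem toLagrange_lagrangeInv (n : ℕ) : toLagrange R (lagrangeInv R n) = S R n := by
  have hc : PowerSeries.map (toLagrange R : NSym R →+* NSym R) (complete R) = lagrange R := by
    ext n
    rw [PowerSeries.coeff_map, complete, PowerSeries.coeff_mk, coeff_lagrange]
    exact toLagrange_S R n
  have h : lagrange R = leftComp (fun k => toLagrange R (lagrangeInv R k)) fun k =>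
      lagrange R ^ k := by
    conv_lhs => rw [← hc, complete_eq_leftComp, map_leftComp]
    simp [hc]
  have h0 : coeff 0 (lagrange R) = 1 := by rw [coeff_lagrange, g_zero]
  induction n using Nat.strong_induction_on with
  | _ n ih =>
    have h1 := congrArg (coeff n) h
    have h2 := congrArg (coeff n) (lagrange_eq_leftComp R)
    rw [coeff_leftComp_pow _ h0] at h1 h2
    rw [h1, Finset.sum_congr rfl fun (k : Fin n) _ => by rw [ih k k.2]] at h2
    exact add_left_cancel h2

/-- The algebra automorphism sending `S_n` to `g_n`. -/
def lagrangeEquiv : NSym R ≃ₐ[R] NSym R :=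
  AlgEquiv.ofAlgHom (toLagrange R) (ofLagrange R)
    (hom_ext R fun n => by
      simp only [AlgHom.comp_apply, AlgHom.id_apply, ofLagrange_S, toLagrange_lagrangeInv])
    (hom_ext R fun n => by
      simp only [AlgHom.comp_apply, AlgHom.id_apply, toLagrange_S, ofLagrange_g])

theorem basisFreeMonoid_apply (I : FreeMonoid ℕ+) :
    FreeAlgebra.basisFreeMonoid R ℕ+ I =
      (I.toList.map (FreeAlgebra.ι R)).prod := by
  simp [FreeAlgebra.basisFreeMonoid, FreeAlgebra.equivMonoidAlgebraFreeMonoid,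
    FreeMonoid.lift_apply]

theorem gComp_eq (I : List ℕ+) : gComp R I = (I.map fun i : ℕ+ => g R i).prod := by
  simp only [gComp, List.bind_eq_flatMap, List.pure_def, List.map_flatMap,
    List.map_cons, List.map_nil]
  rw [← List.map_eq_flatMap]

/-- The basis of products of components of the Lagrange series. -/
def lagrangeBasis : Module.Basis (List ℕ+) R (NSym R) :=
  ((FreeAlgebra.basisFreeMonoid R ℕ+).reindex FreeMonoid.toList).map
    (lagrangeEquiv R).toLinearEquiv

theorem lagrangeBasis_apply (I : List ℕ+) : lagrangeBasis R I = gComp R I := by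
  rw [lagrangeBasis, Module.Basis.map_apply, Module.Basis.reindex_apply, basisFreeMonoid_apply]
  change toLagrange R _ = _
  rw [map_list_prod, List.map_map, gComp_eq]
  congr 1
  refine List.map_congr_left fun n _ => ?_
  rw [Function.comp_apply, ← S_pnat, toLagrange_S]

/-! ## The coproduct of the Lagrange series -/

/-- Both sides solve the Lagrange equation with coefficients ΔS_n = ∑ S_i ⊗ S_j: the left because Δ
is an algebra morphism, the right by `coupled_mul` for the two copies of Sym. -/
theorem map_comul_lagrange (A B : PowerSeries (NSym R ⊗[R] NSym R))
    (hA : A = leftComp (fun n => g R n ⊗ₜ[R] 1) fun k => B ^ k)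
    (hB : B = leftComp (fun n => 1 ⊗ₜ[R] g R n) fun k => A ^ k) :
    PowerSeries.map (comulHom R : NSym R →+* NSym R ⊗[R] NSym R) (lagrange R) = A * B := by
  let iL : NSym R →+* NSym R ⊗[R] NSym R :=
    (Algebra.TensorProduct.includeLeft : NSym R →ₐ[R] NSym R ⊗[R] NSym R)
  let iR : NSym R →+* NSym R ⊗[R] NSym R :=
    (Algebra.TensorProduct.includeRight : NSym R →ₐ[R] NSym R ⊗[R] NSym R)
  have hcomm : ∀ x y, Commute (iL x) (iR y) := fun x y => by
    change (x ⊗ₜ[R] 1) * (1 ⊗ₜ[R] y) = (1 ⊗ₜ[R] y) * (x ⊗ₜ[R] 1)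
    simp
  have hmap : ∀ (i : NSym R →+* NSym R ⊗[R] NSym R), PowerSeries.map i (lagrange R) =
      leftComp (fun k => i (S R k)) fun k => PowerSeries.map i (lagrange R) ^ k := fun i => by
    conv_lhs => rw [lagrange_eq_leftComp, map_leftComp]
    simp only [map_pow]
  have hcoeff : ∀ (i : NSym R →+* NSym R ⊗[R] NSym R) k,
      coeff k (PowerSeries.map i (lagrange R)) = i (g R k) := fun i k => by
    rw [PowerSeries.coeff_map, coeff_lagrange]
  have h := coupled_mul (fun i j => by rw [hcoeff, hcoeff]; exact hcomm _ _) (hmap iL) (hmap iR)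
    (A := A) (B := B) (by simp only [hcoeff]; exact hA) (by simp only [hcoeff]; exact hB)
  refine leftComp_pow_unique (hmap _) ?_
  refine h.trans ?_
  congr 1
  ext1 n
  change _ = comulHom R (S R n)
  rw [comulHom_S]
  refine Finset.sum_congr rfl fun p _ => ?_
  change (S R p.1 ⊗ₜ[R] 1) * (1 ⊗ₜ[R] S R p.2) = _
  simp

/-- The positive entries of a list of natural numbers. -/
def positives (L : List ℕ) : List ℕ+ :=
  L.filterMap fun k => if h : 0 < k then some ⟨k, h⟩ else none

theorem positives_cons_zero (L : List ℕ) : positives (0 :: L) = positives L := rfl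

theorem positives_cons (k : ℕ+) (L : List ℕ) : positives (k :: L) = k :: positives L := by
  rw [positives, List.filterMap_cons_some (b := k)]
  · rfl
  · rw [dif_pos k.pos]
    rfl

theorem positives_eq_iff (L : List ℕ) (I : List ℕ+) :
    positives L = I ↔ L.filter (fun k => decide (k ≠ 0)) = I.map fun i : ℕ+ => (i : ℕ) := by
  have h : (positives L).map (fun i : ℕ+ => (i : ℕ)) = L.filter fun k => decide (k ≠ 0) := by
    induction L with
    | nil => rfl
    | cons k L ih =>
      rcases Nat.eq_zero_or_pos k with rfl | hk
      · exact ih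
      · lift k to ℕ+ using hk
        rw [positives_cons, List.map_cons, ih, List.filter_cons_of_pos]
        simp
  rw [← h]
  exact (List.map_injective_iff.2 PNat.coe_injective).eq_iff.symm

theorem gComp_positives (L : List ℕ) : gComp R (positives L) = (L.map (g R)).prod := by
  rw [gComp_eq]
  induction L with
  | nil => rfl
  | cons k L ih =>
    rcases Nat.eq_zero_or_pos k with rfl | hk
    · rw [positives_cons_zero, ih, List.map_cons, List.prod_cons, g_zero, one_mul]
    · lift k to ℕ+ using hk
      rw [positives_cons, List.map_cons, List.prod_cons, ih, List.map_cons, List.prod_cons]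

-- `seriesA` and `seriesB` solve the coupled system, so Δg_n is a coefficient of their product. Each
-- summand is a word in the g_i ⊗ 1 times a word in the 1 ⊗ g_j, that is, a pure tensor.
open Classical SetPartition NCPerm in
theorem comul_g (n : ℕ) :
    Coalgebra.comul (R := R) (g R n) = ∑ π : SetPartition (n + 1) with π.IsNoncrossing,
      gComp R (positives ((List.range' 0 (n + 1)).map (rho (ext π.toPerm)))) ⊗ₜ[R]
        gComp R (positives ((List.range' 0 (n + 1)).map
          (rho (kreweras (ext π.toPerm) 0 n)))) := by
  let X : ℕ → NSym R ⊗[R] NSym R := fun n => g R n ⊗ₜ[R] 1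
  let Y : ℕ → NSym R ⊗[R] NSym R := fun n => 1 ⊗ₜ[R] g R n
  have hXY : ∀ i j, Commute (X i) (Y j) := fun i j => by
    change (g R i ⊗ₜ[R] 1) * (1 ⊗ₜ[R] g R j) = (1 ⊗ₜ[R] g R j) * (g R i ⊗ₜ[R] 1)
    simp
  have h := map_comul_lagrange R (seriesA X Y) (seriesB X Y) (seriesA_eq hXY) (seriesB_eq hXY)
  have h := congrArg (coeff n) h
  rw [PowerSeries.coeff_map, coeff_lagrange, ← sum_word_eq_coeff hXY
    (by simp only [X, g_zero]; rfl) (by simp only [Y, g_zero]; rfl)] at h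
  refine Eq.trans h (Finset.sum_congr rfl fun π _ => ?_)
  have hX : ∀ w, word X w 0 (n + 1) =
      gComp R (positives ((List.range' 0 (n + 1)).map (rho w))) ⊗ₜ[R] 1 := fun w => by
    rw [gComp_positives, word, List.map_map]
    exact (map_list_prod (Algebra.TensorProduct.includeLeft : NSym R →ₐ[R] NSym R ⊗[R] NSym R) _
      |>.trans (by rw [List.map_map]; rfl)).symm
  have hY : ∀ w, word Y w 0 (n + 1) =
      1 ⊗ₜ[R] gComp R (positives ((List.range' 0 (n + 1)).map (rho w))) := fun w => by
    rw [gComp_positives, word, List.map_map]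
    exact (map_list_prod (Algebra.TensorProduct.includeRight : NSym R →ₐ[R] NSym R ⊗[R] NSym R) _
      |>.trans (by rw [List.map_map]; rfl)).symm
  rw [hX, hY, Algebra.TensorProduct.tmul_mul_tmul, mul_one, one_mul]

-- Each summand of `comul_g` is one element of the tensor basis, so the coordinate counts the
-- partitions with the given pair of types. The complement exists and its permutation is determined
-- by π, hence the condition on π' is one on `kreweras`.
open SetPartition NCPerm in
theorem lagrangeBasis_repr_comul (n : ℕ) (I J : List ℕ+) :
    ((lagrangeBasis R).tensorProduct (lagrangeBasis R)).repr
      (Coalgebra.comul (R := R) (g R n)) (I, J) =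
        (({π : SetPartition (n + 1) | π.IsNoncrossing ∧
            π.reducedOrderedType = I.map (fun i : ℕ+ => (i : ℕ)) ∧
            ∃ π' : SetPartition (n + 1), π.IsRightKrewerasComplement π' ∧
              π'.reducedOrderedType = J.map (fun j : ℕ+ => (j : ℕ))}.ncard : ℕ) : R) := by
  classical
  have hwhite : ∀ (π : SetPartition (n + 1)) (K : List ℕ+),
      positives ((List.range' 0 (n + 1)).map (rho (ext π.toPerm))) = K ↔
        π.reducedOrderedType = K.map (fun i : ℕ+ => (i : ℕ)) := fun π K => by
    rw [positives_eq_iff, reducedOrderedType_eq, map_rho_ext]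
  have hblack : ∀ π : SetPartition (n + 1), π.IsNoncrossing →
      (positives ((List.range' 0 (n + 1)).map (rho (kreweras (ext π.toPerm) 0 n))) = J ↔
        ∃ π' : SetPartition (n + 1), π.IsRightKrewerasComplement π' ∧
          π'.reducedOrderedType = J.map (fun j : ℕ+ => (j : ℕ))) := fun π hπ => by
    have key : ∀ π', π.IsRightKrewerasComplement π' →
        kreweras (ext π.toPerm) 0 n = ext π'.toPerm := fun π' h => by
      rw [h.2, ext_inv_mul_finRotate]
    constructor
    · intro h
      obtain ⟨π', hπ'⟩ := hπ.exists_kreweras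
      rw [key π' hπ', hwhite] at h
      exact ⟨π', hπ', h⟩
    · rintro ⟨π', hπ', h⟩
      rwa [key π' hπ', hwhite]
  rw [comul_g, map_sum, Finsupp.finsetSum_apply, Set.ncard_eq_toFinset_card', Finset.card_eq_sum_ones,
    Nat.cast_sum, Set.toFinset_ofPred, Finset.sum_filter, Finset.sum_filter]
  refine Finset.sum_congr rfl fun π _ => ?_
  by_cases hπ : π.IsNoncrossing
  · rw [if_pos hπ, ← lagrangeBasis_apply, ← lagrangeBasis_apply,
      ← Module.Basis.tensorProduct_apply, Module.Basis.repr_self, Finsupp.single_apply]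
    simp only [Prod.mk.injEq, hwhite, hblack π hπ, hπ, true_and, Nat.cast_one]
  · simp only [hπ, if_false, false_and]

end NSym

end

theorem mainTheorem1 (R : Type*) [CommRing R] :
    ∃ b : Module.Basis (List ℕ+) R (NSym R),
      (∀ I : List ℕ+, b I = NSym.gComp R I) ∧
      ∀ (n : ℕ) (I J : List ℕ+),
        (b.tensorProduct b).repr (Coalgebra.comul (R := R) (NSym.g R n)) (I, J) =
          (({π : SetPartition (n + 1) | π.IsNoncrossing ∧
              π.reducedOrderedType = I.map (fun i : ℕ+ => (i : ℕ)) ∧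
              ∃ π' : SetPartition (n + 1), π.IsRightKrewerasComplement π' ∧
                π'.reducedOrderedType = J.map (fun j : ℕ+ => (j : ℕ))}.ncard : ℕ) : R) :=
  ⟨NSym.lagrangeBasis R, NSym.lagrangeBasis_apply R, NSym.lagrangeBasis_repr_comul R⟩
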